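/- Let $m>2$, $d\in\mathbb N$, $R>0$, $\kappa>0$, $T>0$, $r\in\mathbb R$, $\mu\in\mathbb R^d$, and let $\sigma\in\mathbb R^{d\times d}$ be such that $\sigma\sigma^\top$ is positive definite. Put $m^*=\frac1{3m-2}$, $\mathfrak S=(\sigma\sigma^\top)^{1/2}$ (the positive semidefinite square root), $\pi=R^{-1}(\sigma\sigma^\top)^{-1}(\mu-r\mathbb 1)$, where $\mathbb 1=(1,\dots,1)^\top$, let $\Sigma$ be the $d\times d$ matrix whose $i$-th column is $\pi_i\,\mathfrak S^{-1}(\mu-r\mathbb 1-R\sigma\sigma^\top e_i)$, where $e_i$ is the $i$-th canonical basis vector, and let $A=(\Sigma\mathfrak S)^\top(\Sigma\mathfrak S)$. Assume that $A_{jj}>0$ for all $j$. (a) There is exactly one pair $(\lambda_m,\tilde\varpi^1)$, with $\lambda_m\in\mathbb R$ and $\tilde\varpi^1:\mathbb R\to\mathbb R$ of class $C^2$, such that $\tilde\varpi^1(0)=0$, $$(\tilde\varpi^1)''(x)=-x^2+\lambda_m+\frac{m^{-m}}{(m-1)^{1-m}}\,\big|(\tilde\varpi^1)'(x)\big|^m\quad(x\in\mathbb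 R),\qquad \lim_{x\to\pm\infty}\frac{(\tilde\varpi^1)'(x)}{|x|^{2/m}}=\pm m(m-1)^{\frac1m-1};$$ it depends only on $m$, and $\lambda_m>0$. (b) Call a real constant $\lambda$ and a function $\tilde\varpi$ on $[0,T]\times\mathbb R_+\times\mathbb R^d\times\mathbb R^d$ (with $\mathbb R_+=[0,\infty)$), of class $C^2$ in its last variable $x$, a solution if for all $(t,w,s,x)$ $$\frac R2|x|^2-\frac1m\sum_{j=1}^d\kappa^{1-m}\big|\tilde\varpi_{x_j}(t,w,s,x)\big|^m+\frac1{2R^2}\mathrm{Tr}\big(\tilde\varpi_{xx}(t,w,s,x)\,A\big)=\lambda,$$ $\tilde\varpi(t,w,s,0)=0$, $\tilde\varpi\ge0$, and $\liminf_{|x|\to\infty}\tilde\varpi(t,w,s,x)>0$ for every $(t,w,s)$. There is exactly one solution $(\lambda,\tilde\varpi)$. It does not depend on $(t,w,s)$, and is given by $\tilde\varpi(x)=\sum_{j=1}^d\beta_j\,\tilde\varpi^1(\gamma_jx_j)$ and $\lambda=\lambda_m\sum_{j=1}^d\frac R{2\gamma_j^2}$, where $$\gamma_j=\Big(2\Big(\frac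 m{\kappa(m-1)}\Big)^{m-1}\frac{R^{3m-1}}{(A_{jj})^m}\Big)^{m^*},\qquad \beta_j=2^{-4m^*}(A_{jj})^{4mm^*-1}R^{-1-4m^*}\Big(\frac{\kappa(m-1)}m\Big)^{4(m-1)m^*}.$$ (c) The functions $\tilde\varpi^1$ and $\tilde\varpi$ are $C^2$ and convex, $$\lim_{|x|\to\infty}\frac{\tilde\varpi^1(x)}{|x|^{1+\frac2m}}=\frac{m^2}{(m+2)(m-1)^{1-\frac1m}},$$ there is a constant $C>0$ with $$\frac{(1+|x|^2)^{\frac12+\frac1m}}C-C\le\tilde\varpi(x)\le C(1+|x|^2)^{\frac12+\frac1m}\qquad(x\in\mathbb R^d),$$ $\tilde\varpi(x)\neq0$ for $x\ne0$, and there is a constant $K$ such that for all $i\in\{1,\dots,d\}$ and all $x\in\mathbb R^d\setminus\{0\}$ $$\Big|\frac{\tilde\varpi_{x_i}(x)\,x_i}{\tilde\varpi(x)}\Big|+\Big|\frac{\tilde\varpi_{x_i}(x)}{|x|}\Big|+\Big|\frac{\tilde\varpi_{x_i}(x)}{1+|x|^{2/m}}\Big|\le K.$$ -/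

import Mathlib

open Filter Topology Set
open scoped Matrix

noncomputable section

namespace PriceImpact

/-! ### Partial derivatives on Euclidean space -/

/-- The partial derivative of `φ` in the `i`-th coordinate direction. -/
def pderiv {d : ℕ} (i : Fin d) (φ : EuclideanSpace ℝ (Fin d) → ℝ)
    (x : EuclideanSpace ℝ (Fin d)) : ℝ :=
  fderiv ℝ φ x (EuclideanSpace.single i 1)

/-- The Hessian matrix of second partial derivatives of `φ` at `x`. -/
def hessian {d : ℕ} (φ : EuclideanSpace ℝ (Fin d) → ℝ)
    (x : EuclideanSpace ℝ (Fin d)) : Matrix (Fin d) (Fin d) ℝ :=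
  Matrix.of fun i j => pderiv i (pderiv j φ) x

/-! ### The data of the Black-Scholes model -/

section SqrtCov

open scoped MatrixOrder

/-- `𝔖 = (σ σᵀ)^{1/2}`, the positive semidefinite square root. -/
def sqrtCov {d : ℕ} (σ : Matrix (Fin d) (Fin d) ℝ) : Matrix (Fin d) (Fin d) ℝ :=
  CFC.sqrt (σ * σᵀ)

end SqrtCov

/-- The excess return vector `μ - r 𝟙`. -/
def excess {d : ℕ} (μ : Fin d → ℝ) (r : ℝ) : Fin d → ℝ := fun i => μ i - r

/-- The Merton proportions `π = R⁻¹ (σ σᵀ)⁻¹ (μ - r 𝟙)`. -/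
def merton {d : ℕ} (σ : Matrix (Fin d) (Fin d) ℝ) (μ : Fin d → ℝ) (r R : ℝ) : Fin d → ℝ :=
  R⁻¹ • ((σ * σᵀ)⁻¹ *ᵥ excess μ r)

/-- The matrix `Σ` whose `i`-th column is `π_i 𝔖⁻¹ (μ - r 𝟙 - R σ σᵀ e_i)`. -/
def SigmaMat {d : ℕ} (σ : Matrix (Fin d) (Fin d) ℝ) (μ : Fin d → ℝ) (r R : ℝ) :
    Matrix (Fin d) (Fin d) ℝ :=
  Matrix.of fun k i =>
    merton σ μ r R i *
      ((sqrtCov σ)⁻¹ *ᵥ (excess μ r - R • ((σ * σᵀ) *ᵥ Pi.single i 1))) k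

/-- The diffusion matrix `(Σ 𝔖)ᵀ (Σ 𝔖)` of the reduced first corrector equation. -/
def diffMat {d : ℕ} (σ : Matrix (Fin d) (Fin d) ℝ) (μ : Fin d → ℝ) (r R : ℝ) :
    Matrix (Fin d) (Fin d) ℝ :=
  (SigmaMat σ μ r R * sqrtCov σ)ᵀ * (SigmaMat σ μ r R * sqrtCov σ)

/-! ### The one-dimensional corrector -/

/-- `(lam, φ)` is a solution of the one-dimensional corrector problem with exponent `m`:
`φ` is `C²`, `φ'' (x) = -x² + lam + m^{-m} (m-1)^{m-1} |φ'(x)|^m`, `φ(0) = 0`, and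
`φ'(x) / |x|^{2/m} → ± m (m-1)^{1/m-1}` as `x → ±∞`. -/
structure IsOneDimCorrector (m lam : ℝ) (φ : ℝ → ℝ) : Prop where
  contDiff : ContDiff ℝ 2 φ
  ode : ∀ x : ℝ, deriv (deriv φ) x =
    -x ^ 2 + lam + m ^ (-m) / (m - 1) ^ (1 - m) * |deriv φ x| ^ m
  zero : φ 0 = 0
  tendsto_atTop : Tendsto (fun x : ℝ => deriv φ x / |x| ^ (2 / m)) atTop
    (𝓝 (m * (m - 1) ^ (1 / m - 1)))
  tendsto_atBot : Tendsto (fun x : ℝ => deriv φ x / |x| ^ (2 / m)) atBot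
    (𝓝 (-(m * (m - 1) ^ (1 / m - 1))))

/-! ### The reduced multidimensional first corrector equation -/

/-- `(lam, ϖ)` is a solution of the reduced first corrector equation on
`[0,T] × ℝ₊ × ℝᵈ × ℝᵈ` with diffusion matrix `A`, vanishing at `x = 0`, nonnegative, and with
positive lower limit as `|x| → ∞`. The variables `t, w, s` are parameters of the equation. -/
structure IsReducedCorrector {d : ℕ} (m R κ T : ℝ) (A : Matrix (Fin d) (Fin d) ℝ)
    (lam : ℝ) (ϖ : ℝ → ℝ → (Fin d → ℝ) → EuclideanSpace ℝ (Fin d) → ℝ) : Prop where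
  contDiff : ∀ t ∈ Icc 0 T, ∀ w ∈ Ici (0 : ℝ), ∀ s, ContDiff ℝ 2 (ϖ t w s)
  pde : ∀ t ∈ Icc 0 T, ∀ w ∈ Ici (0 : ℝ), ∀ s, ∀ x,
    R / 2 * ‖x‖ ^ 2 - 1 / m * ∑ j, κ ^ (1 - m) * |pderiv j (ϖ t w s) x| ^ m
      + 1 / (2 * R ^ 2) * Matrix.trace (hessian (ϖ t w s) x * A) = lam
  zero : ∀ t ∈ Icc 0 T, ∀ w ∈ Ici (0 : ℝ), ∀ s, ϖ t w s 0 = 0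
  nonneg : ∀ t ∈ Icc 0 T, ∀ w ∈ Ici (0 : ℝ), ∀ s, ∀ x, 0 ≤ ϖ t w s x
  liminf_pos : ∀ t ∈ Icc 0 T, ∀ w ∈ Ici (0 : ℝ), ∀ s,
    0 < liminf (fun x => ((ϖ t w s x : ℝ) : EReal))
      (cocompact (EuclideanSpace ℝ (Fin d)))

/-! ### The explicit constants -/

/-- `m* = 1 / (3m - 2)`. -/
def mStar (m : ℝ) : ℝ := 1 / (3 * m - 2)

/-- `γ_j`, for the `j`-th diagonal entry `a` of the diffusion matrix. -/
def gammaCoef (m R κ a : ℝ) : ℝ :=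
  (2 * (m / (κ * (m - 1))) ^ (m - 1) * (R ^ (3 * m - 1) / a ^ m)) ^ mStar m

/-- `β_j`, for the `j`-th diagonal entry `a` of the diffusion matrix. -/
def betaCoef (m R κ a : ℝ) : ℝ :=
  (2 : ℝ) ^ (-4 * mStar m) * a ^ (4 * m * mStar m - 1) * R ^ (-1 - 4 * mStar m)
    * (κ * (m - 1) / m) ^ (4 * (m - 1) * mStar m)

/-- The separable function `x ↦ ∑ j, β_j φ(γ_j x_j)`. -/
def sepCorrector {d : ℕ} (m R κ : ℝ) (A : Matrix (Fin d) (Fin d) ℝ) (φ : ℝ → ℝ)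
    (x : EuclideanSpace ℝ (Fin d)) : ℝ :=
  ∑ j, betaCoef m R κ (A j j) * φ (gammaCoef m R κ (A j j) * x j)

/-- The constant `lam1 * ∑ j, R / (2 γ_j²)`. -/
def sepConst {d : ℕ} (m R κ : ℝ) (A : Matrix (Fin d) (Fin d) ℝ) (lam1 : ℝ) : ℝ :=
  lam1 * ∑ j, R / (2 * gammaCoef m R κ (A j j) ^ 2)

end PriceImpact

end

/-!
# The reduced first corrector equation with power price impact

Existence is explicit up to a scalar ODE. For the derivative `p` of the one-dimensional
corrector the problem reads `p' = lam - x² + c |p|^m`, and with `ℓ` the prescribed limit of `p /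
x^(2/m)` one has `c ℓ^m = 1` (`corrector_coefficients`). Start at `p(0) = 0` and vary `lam`: for
small `lam` the solution eventually decreases, for large `lam` it crosses the barrier `ℓ (x +
b)^(2/m)`. Both sets of parameters are open and they are disjoint, so by connectedness some
`lam` lies in neither (`exists_shooting_parameter`). For this `lam` the solution is
nondecreasing, which keeps it above the nullcline `ℓ (x² - lam)^(1/m)`, and it stays below the
barrier; both bounds have the required asymptotics. Its odd extension is an `IsOddProfile`, and
the primitive of the profile is an even convex corrector. All growth and derivative bounds come
from these two barriers at infinity and from `p(x) ≈ lam x` at the origin.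

The choice of `γⱼ` and `βⱼ` makes the separable sum `∑ⱼ βⱼ φ(γⱼ xⱼ)` solve the multidimensional
equation: its Hessian is diagonal, so only the diagonal of `A` enters, and each coordinate
contributes a rescaled copy of the scalar equation (`IsOddProfile.sepCorrector_pde`).

Uniqueness, in both the scalar and the multidimensional problem, is an instance of
`IsErgodicSolution.unique` for equations `∑ₖ D²f(aₖ, aₖ) - H(Df) + q = lam`, where `A = Mᵀ M`
gives the vectors `aₖ` as the rows of `M`. The matrix `A` may be singular, so neither elliptic
regularity nor the classical strong maximum principle is available. The argument is as follows.

* Nonnegative solutions are coercive (`IsErgodicSolution.coercive`), and by superquadraticity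
  and homogeneity of `H` any two satisfy `θ g - C ≤ f` for each `θ < 1`
  (`IsErgodicSolution.exists_le_of_lt_one`). So `f - θ g` attains its minimum, at points that
  remain in a fixed compact set as `θ → 1`. This shows that the constants agree
  (`IsErgodicSolution.const_le`) and that `g - f` attains its extrema
  (`IsErgodicSolution.exists_min_sub`).
* The set of maximum points of `g - f` is invariant under translation along the diffusion
  directions `aₖ` (`IsErgodicSolution.argmax_invariant`). In the orthogonal complement of these
  directions the drift `-∇H(Df)` decreases the norm, since each partial derivative of the
  separable solution `f` has the sign of its coordinate. Hence the origin is a maximum point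
  (`IsErgodicSolution.zero_mem_argmax`). It is likewise a minimum point, so `g - f` is constant,
  and the normalization at the origin makes the constant zero.
-/

noncomputable section

namespace PriceImpact

/-! ### Second-order conditions at local minima -/

/-- The second derivative of `f` at `x` in the direction `v`. -/
def secondDeriv {E : Type*} [NormedAddCommGroup E] [NormedSpace ℝ E]
    (f : E → ℝ) (x v : E) : ℝ :=
  fderiv ℝ (fderiv ℝ f) x v v

section SecondDeriv

variable {E : Type*} [NormedAddCommGroup E] [NormedSpace ℝ E]

lemma differentiable_fderiv {f : E → ℝ} (hf : ContDiff ℝ 2 f) :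
    Differentiable ℝ (fderiv ℝ f) :=
  (hf.fderiv_right (m := 1) (by norm_num)).differentiable (by norm_num)

lemma differentiable_of_contDiff_two {f : E → ℝ} (hf : ContDiff ℝ 2 f) : Differentiable ℝ f :=
  hf.differentiable (by norm_num)

lemma continuous_fderiv_of_contDiff_two {f : E → ℝ} (hf : ContDiff ℝ 2 f) :
    Continuous (fderiv ℝ f) :=
  (differentiable_fderiv hf).continuous

lemma continuous_secondDeriv {f : E → ℝ} (hf : ContDiff ℝ 2 f) (v : E) :
    Continuous fun x => secondDeriv f x v := by
  have h : Continuous (fderiv ℝ (fderiv ℝ f)) :=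
    (hf.fderiv_right (m := 1) (by norm_num)).continuous_fderiv (by norm_num)
  exact (h.clm_apply continuous_const).clm_apply continuous_const

lemma fderiv_add_const_mul {f g : E → ℝ} (hf : ContDiff ℝ 2 f) (hg : ContDiff ℝ 2 g) (c : ℝ) :
    fderiv ℝ (fun x => f x + c * g x) = fun x => fderiv ℝ f x + c • fderiv ℝ g x := by
  ext1 x
  exact (((differentiable_of_contDiff_two hf) x).hasFDerivAt.add
    (((differentiable_of_contDiff_two hg) x).hasFDerivAt.const_mul c)).fderiv

lemma secondDeriv_add_const_mul {f g : E → ℝ} (hf : ContDiff ℝ 2 f) (hg : ContDiff ℝ 2 g)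
    (c : ℝ) (x v : E) :
    secondDeriv (fun x => f x + c * g x) x v = secondDeriv f x v + c * secondDeriv g x v := by
  have h := (((differentiable_fderiv hf) x).hasFDerivAt.add
    (((differentiable_fderiv hg) x).hasFDerivAt.const_smul c)).fderiv
  rw [secondDeriv, fderiv_add_const_mul hf hg]
  erw [h]
  simp [secondDeriv]

/-- Chain rule for the second directional derivative. -/
lemma secondDeriv_comp {ψ ψ' ψ'' : ℝ → ℝ} (hψ : ∀ s, HasDerivAt ψ (ψ' s) s)
    (hψ' : ∀ s, HasDerivAt ψ' (ψ'' s) s) {g : E → ℝ} (hg : ContDiff ℝ 2 g) (x v : E) :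
    secondDeriv (fun y => ψ (g y)) x v =
      ψ' (g x) * secondDeriv g x v + ψ'' (g x) * (fderiv ℝ g x v) ^ 2 := by
  have hg1 := differentiable_of_contDiff_two hg
  have h1 : fderiv ℝ (fun y => ψ (g y)) = fun y => ψ' (g y) • fderiv ℝ g y := by
    ext1 y
    exact ((hψ (g y)).comp_hasFDerivAt y (hg1 y).hasFDerivAt).fderiv
  have h2 := (((hψ' (g x)).comp_hasFDerivAt x (hg1 x).hasFDerivAt).smul
    ((differentiable_fderiv hg) x).hasFDerivAt).fderiv
  rw [secondDeriv, h1]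
  erw [h2]
  simp [secondDeriv]
  ring

lemma fderiv_comp_of_hasDerivAt {ψ ψ' : ℝ → ℝ} (hψ : ∀ s, HasDerivAt ψ (ψ' s) s)
    {g : E → ℝ} (hg : ContDiff ℝ 2 g) (x : E) :
    fderiv ℝ (fun y => ψ (g y)) x = ψ' (g x) • fderiv ℝ g x :=
  ((hψ (g x)).comp_hasFDerivAt x ((differentiable_of_contDiff_two hg) x).hasFDerivAt).fderiv

/-- The second-order necessary condition at a local minimum. If the second derivative were
negative, the restriction to a line would also have a local maximum, hence be constant. -/
lemma IsLocalMin.secondDeriv_nonneg {f : E → ℝ} (hf : ContDiff ℝ 2 f) {x : E}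
    (h : IsLocalMin f x) (v : E) : 0 ≤ secondDeriv f x v := by
  have hl : ∀ s : ℝ, HasDerivAt (fun s : ℝ => x + s • v) v s := fun s => by
    simpa using ((hasDerivAt_id s).smul_const v).const_add x
  have hd : deriv (fun s : ℝ => f (x + s • v)) = fun s => fderiv ℝ f (x + s • v) v := by
    ext1 s
    exact ((differentiable_of_contDiff_two hf _).hasFDerivAt.comp_hasDerivAt s (hl s)).deriv
  have hdd : deriv (deriv fun s : ℝ => f (x + s • v)) 0 = secondDeriv f x v := by
    rw [hd]
    have h0 : HasFDerivAt (fderiv ℝ f) (fderiv ℝ (fderiv ℝ f) x) (x + (0 : ℝ) • v) := by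
      simpa using (differentiable_fderiv hf x).hasFDerivAt
    have h1 : HasDerivAt (fun s : ℝ => fderiv ℝ f (x + s • v)) (fderiv ℝ (fderiv ℝ f) x v) 0 :=
      h0.comp_hasDerivAt 0 (hl 0)
    have h2 := h1.clm_apply (hasDerivAt_const (0 : ℝ) v)
    simpa [secondDeriv] using h2.deriv
  have hc : Continuous fun s : ℝ => f (x + s • v) := by
    have := hf.continuous
    fun_prop
  have hmin : IsLocalMin (fun s : ℝ => f (x + s • v)) 0 := by
    have ht : Tendsto (fun s : ℝ => x + s • v) (𝓝 0) (𝓝 x) := by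
      have : Continuous fun s : ℝ => x + s • v := by fun_prop
      simpa using this.tendsto 0
    have := ht.eventually h
    simpa [IsLocalMin, IsMinFilter] using this
  by_contra hneg
  push Not at hneg
  rw [← hdd] at hneg
  have hmax := isLocalMax_of_deriv_deriv_neg hneg hmin.deriv_eq_zero hc.continuousAt
  have hconst : (fun s : ℝ => f (x + s • v)) =ᶠ[𝓝 0] fun _ => f (x + (0 : ℝ) • v) := by
    filter_upwards [hmin, hmax] with s h1 h2
    exact le_antisymm h2 h1
  have h0 : deriv (deriv fun s : ℝ => f (x + s • v)) 0 = 0 := by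
    rw [hconst.deriv.deriv_eq]
    simp
  exact absurd h0 hneg.ne

/-- First- and second-order conditions where `w` touches `f` from below. -/
lemma IsLocalMin.sub_conditions {f w : E → ℝ} (hf : ContDiff ℝ 2 f) (hw : ContDiff ℝ 2 w) {x : E}
    (h : IsLocalMin (fun y => f y - w y) x) :
    fderiv ℝ f x = fderiv ℝ w x ∧ ∀ v, secondDeriv w x v ≤ secondDeriv f x v := by
  have he : (fun y => f y - w y) = fun y => f y + (-1) * w y := by ext; ring
  rw [he] at h
  constructor
  · have := h.fderiv_eq_zero
    rw [fderiv_add_const_mul hf hw] at this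
    simpa [← sub_eq_add_neg, sub_eq_zero] using this
  · intro v
    have := IsLocalMin.secondDeriv_nonneg (by fun_prop) h v
    rw [secondDeriv_add_const_mul hf hw] at this
    linarith

end SecondDeriv

section Quadratic

variable {E : Type*} [NormedAddCommGroup E] [InnerProductSpace ℝ E]

lemma contDiff_normSq_sub (L : E →L[ℝ] E) (p : E) :
    ContDiff ℝ 2 fun x => ‖L x - p‖ ^ 2 :=
  ((L.contDiff.sub contDiff_const)).norm_sq ℝ

lemma fderiv_normSq_sub (L : E →L[ℝ] E) (p x v : E) :
    fderiv ℝ (fun x => ‖L x - p‖ ^ 2) x v = 2 * inner ℝ (L x - p) (L v) := by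
  have h := ((L.hasFDerivAt (x := x)).sub_const p).norm_sq
  rw [h.fderiv]
  simp [inner_sub_left]

lemma secondDeriv_normSq_sub (L : E →L[ℝ] E) (p x v : E) :
    secondDeriv (fun x => ‖L x - p‖ ^ 2) x v = 2 * ‖L v‖ ^ 2 := by
  have hd := (differentiable_fderiv (contDiff_normSq_sub L p)) x
  have h1 : secondDeriv (fun x => ‖L x - p‖ ^ 2) x v
      = fderiv ℝ (fun y => fderiv ℝ (fun x => ‖L x - p‖ ^ 2) y v) x v := by
    have := (hd.hasFDerivAt.clm_apply (hasFDerivAt_const v x)).fderiv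
    erw [this]
    simp [secondDeriv]
  rw [h1]
  simp_rw [fderiv_normSq_sub]
  have h2 := ((((L.hasFDerivAt (x := x)).sub_const p).inner ℝ
    (hasFDerivAt_const (L v) x))).const_mul 2
  rw [h2.fderiv]
  simp

end Quadratic

/-! ### Superquadratic Hamiltonians and ergodic solutions -/

/-- A nonnegative superquadratic Hamiltonian on the dual of `E`, positively homogeneous of degree
`m`, together with a continuous selection `B` of its subgradients. -/
structure IsSuperquadratic {E : Type*} [NormedAddCommGroup E] [NormedSpace ℝ E]
    (m : ℝ) (H : (E →L[ℝ] ℝ) → ℝ) (B : (E →L[ℝ] ℝ) → E) : Prop where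
  continuous : Continuous H
  nonneg : ∀ p, 0 ≤ H p
  hom : ∀ s : ℝ, 0 ≤ s → ∀ p, H (s • p) = s ^ m * H p
  continuous_drift : Continuous B
  subgrad : ∀ p q, H p + (q - p) (B p) ≤ H q
  superquad : ∀ δ > 0, ∃ C, ∀ p, ‖p‖ ^ 2 ≤ δ * H p + C

/-- `f` is a `C²` solution of the ergodic equation `∑ₖ D²f(aₖ, aₖ) - H(Df) + q = lam`. The
diffusion matrix `∑ₖ aₖ ⊗ aₖ` may be degenerate. -/
structure IsErgodicSolution {E ι : Type*} [NormedAddCommGroup E] [NormedSpace ℝ E] [Fintype ι]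
    (a : ι → E) (H : (E →L[ℝ] ℝ) → ℝ) (q : E → ℝ) (lam : ℝ) (f : E → ℝ) : Prop where
  contDiff : ContDiff ℝ 2 f
  eq : ∀ x, ∑ k, secondDeriv f x (a k) - H (fderiv ℝ f x) + q x = lam

section Comparison

variable {E ι : Type*} [NormedAddCommGroup E] [InnerProductSpace ℝ E] [FiniteDimensional ℝ E]
  [Fintype ι] {a : ι → E} {m : ℝ} {H : (E →L[ℝ] ℝ) → ℝ} {B : (E →L[ℝ] ℝ) → E} {q : E → ℝ}

/-- A nonnegative solution is coercive: on the unit ball around a remote point `x₀` it dominates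
the strict subsolution `h (1 - ‖x - x₀‖²)`. -/
lemma IsErgodicSolution.coercive (hH : IsSuperquadratic m H B)
    (hq : Tendsto q (cocompact E) atTop) {lam : ℝ} {f : E → ℝ}
    (hf : IsErgodicSolution a H q lam f) (hf0 : ∀ x, 0 ≤ f x) :
    Tendsto f (cocompact E) atTop := by
  rw [tendsto_atTop]
  intro h₀
  obtain ⟨h, hh0, hhpos⟩ : ∃ h : ℝ, h₀ ≤ h ∧ 0 < h := ⟨max h₀ 1, le_max_left _ _, by positivity⟩
  obtain ⟨Hm, hHm⟩ : ∃ Hm, ∀ p : E →L[ℝ] ℝ, ‖p‖ ≤ 2 * h → H p ≤ Hm := by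
    obtain ⟨Hm, hHm⟩ := (isCompact_closedBall (0 : E →L[ℝ] ℝ) (2 * h)).bddAbove_image
      hH.continuous.continuousOn
    exact ⟨Hm, fun p hp => hHm ⟨p, by simpa using hp, rfl⟩⟩
  set S := ∑ k, ‖a k‖ ^ 2 with hS
  have hev := hq.eventually_gt_atTop (lam + 2 * h * S + Hm)
  rw [← Metric.cobounded_eq_cocompact] at hev ⊢
  obtain ⟨ρ, hρ⟩ := ((Metric.hasBasis_cobounded_compl_closedBall (0 : E)).eventually_iff).1 hev
  rw [(Metric.hasBasis_cobounded_compl_closedBall (0 : E)).eventually_iff]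
  refine ⟨ρ + 1, trivial, fun x₀ hx₀ => hh0.trans ?_⟩
  by_contra hlt
  push Not at hlt
  set r : E → ℝ := fun x => ‖ContinuousLinearMap.id ℝ E x - x₀‖ ^ 2 with hr
  have hrC : ContDiff ℝ 2 r := contDiff_normSq_sub _ _
  set w : E → ℝ := fun x => (h : ℝ) + (-h) * r x with hw
  have hwC : ContDiff ℝ 2 w := by fun_prop
  obtain ⟨x, hx, hxmin⟩ := (isCompact_closedBall x₀ 1).exists_isMinOn
    ⟨x₀, by simp⟩ (f := fun x => f x - w x)
    (hf.contDiff.continuous.sub hwC.continuous).continuousOn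
  have hx0 : f x₀ - w x₀ < 0 := by simp [hw, hr]; linarith
  have hval : f x - w x < 0 := lt_of_le_of_lt (hxmin (by simp)) hx0
  have hxball : ‖x - x₀‖ < 1 := by
    have hle : ‖x - x₀‖ ≤ 1 := by simpa [dist_eq_norm] using hx
    refine lt_of_le_of_ne hle fun he => ?_
    have : w x = 0 := by simp [hw, hr, he]
    linarith [hf0 x]
  have hloc : IsLocalMin (fun y => f y - w y) x :=
    hxmin.isLocalMin (mem_of_superset (Metric.isOpen_ball.mem_nhds
      (show x ∈ Metric.ball x₀ 1 by simpa [dist_eq_norm] using hxball))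
      Metric.ball_subset_closedBall)
  obtain ⟨h1, h2⟩ := IsLocalMin.sub_conditions hf.contDiff hwC hloc
  have hcst : ContDiff ℝ 2 fun _ : E => h := contDiff_const
  have hDw : ‖fderiv ℝ w x‖ ≤ 2 * h := by
    refine ContinuousLinearMap.opNorm_le_bound _ (by positivity) fun v => ?_
    rw [hw, fderiv_add_const_mul hcst hrC]
    have hrv : fderiv ℝ r x v = 2 * inner ℝ (x - x₀) v :=
      fderiv_normSq_sub (ContinuousLinearMap.id ℝ E) x₀ x v
    simp only [fderiv_fun_const, Pi.zero_apply, zero_add, smul_apply, hrv,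
      smul_eq_mul, Real.norm_eq_abs]
    have hi := abs_real_inner_le_norm (x - x₀) v
    have : ‖x - x₀‖ * ‖v‖ ≤ 1 * ‖v‖ := by gcongr
    rw [abs_mul, abs_neg, abs_of_pos hhpos, abs_mul, abs_two]
    nlinarith
  have hDDw : ∑ k, secondDeriv w x (a k) = -(2 * h * S) := by
    rw [hS, Finset.mul_sum, ← Finset.sum_neg_distrib]
    refine Finset.sum_congr rfl fun k _ => ?_
    rw [hw, secondDeriv_add_const_mul hcst hrC, hr, secondDeriv_normSq_sub]
    simp [secondDeriv]
    ring
  have hsum : ∑ k, secondDeriv w x (a k) ≤ ∑ k, secondDeriv f x (a k) :=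
    Finset.sum_le_sum fun k _ => h2 (a k)
  have hqx : lam + 2 * h * S + Hm < q x := by
    refine hρ.2 ?_
    have hx₀' : ρ + 1 < ‖x₀‖ := by simpa using hx₀
    have : ‖x₀‖ ≤ ‖x‖ + ‖x - x₀‖ := by
      have := norm_sub_le x (x - x₀)
      simpa using this
    simp only [mem_compl_iff, Metric.mem_closedBall, dist_zero_right, not_le]
    linarith
  have heq := hf.eq x
  rw [h1] at heq
  have := hHm _ hDw
  linarith

/-- Comparison with a bounded concave function `θ M (1 - exp (-g / M))` of a second solution:
superquadraticity absorbs the second-order error `|Dg|² / M`, uniformly in `M ≥ 1`. -/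
lemma IsErgodicSolution.exists_le_of_lt_one (hm : 1 < m) (hH : IsSuperquadratic m H B)
    (hq0 : ∀ x, 0 ≤ q x) (hq : Tendsto q (cocompact E) atTop) {lf lg : ℝ} {f g : E → ℝ}
    (hf : IsErgodicSolution a H q lf f) (hf0 : ∀ x, 0 ≤ f x)
    (hg : IsErgodicSolution a H q lg g) (hg0 : ∀ x, 0 ≤ g x)
    {θ : ℝ} (hθ0 : 0 < θ) (hθ1 : θ < 1) :
    ∃ C, ∀ x, θ * g x - C ≤ f x := by
  set S := ∑ k, ‖a k‖ ^ 2 with hS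
  have hS0 : 0 ≤ S := Finset.sum_nonneg fun _ _ => by positivity
  have hδ : 0 < 1 - θ ^ (m - 1) := by
    have := Real.rpow_lt_one hθ0.le hθ1 (sub_pos.2 hm)
    linarith
  obtain ⟨C₁, hC₁⟩ := hH.superquad ((1 - θ ^ (m - 1)) / (S + 1)) (by positivity)
  -- all the minimum points below lie in `{q ≤ Q}`
  set Q := (|lf| + |lg| + (S + 1) * |C₁|) / (1 - θ) with hQ
  obtain ⟨K, hK, hKq⟩ : ∃ K : Set E, IsCompact K ∧ ∀ x, q x ≤ Q → x ∈ K := by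
    have hev := hq.eventually_gt_atTop Q
    obtain ⟨K, hK, hKs⟩ := mem_cocompact.1 hev
    exact ⟨K, hK, fun x hx => by
      by_contra hxK
      exact absurd (hKs hxK) (by simpa using hx)⟩
  obtain ⟨G, hG⟩ := hK.bddAbove_image hg.contDiff.continuous.continuousOn
  have hGb : ∀ x ∈ K, g x ≤ G := fun x hx => hG ⟨x, hx, rfl⟩
  have key : ∀ M : ℝ, 1 ≤ M → ∀ x, θ * (M * (1 - Real.exp (-(g x) / M))) - θ * G ≤ f x := by
    intro M hM x
    have hM0 : 0 < M := by linarith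
    set ψ : ℝ → ℝ := fun s => θ * (M * (1 - Real.exp (-s / M))) with hψdef
    set ψ' : ℝ → ℝ := fun s => θ * Real.exp (-s / M) with hψ'def
    set ψ'' : ℝ → ℝ := fun s => -(θ * Real.exp (-s / M)) / M with hψ''def
    have hexp : ∀ s, HasDerivAt (fun s : ℝ => Real.exp (-s / M)) (Real.exp (-s / M) * (-1 / M)) s :=
      fun s => (((hasDerivAt_id s).neg).div_const M).exp
    have hψ : ∀ s, HasDerivAt ψ (ψ' s) s := fun s => by
      convert! (((hexp s).const_sub 1).const_mul M).const_mul θ using 1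
      simp only [hψ'def]; field_simp
    have hψ' : ∀ s, HasDerivAt ψ' (ψ'' s) s := fun s => by
      convert! (hexp s).const_mul θ using 1
      simp only [hψ''def]; field_simp
    have hwC : ContDiff ℝ 2 fun y => ψ (g y) := by
      have := hg.contDiff
      simp only [hψdef]
      fun_prop
    have hψb : ∀ s, ψ s ≤ θ * M := fun s => by
      have := Real.exp_pos (-s / M)
      simp only [hψdef]
      nlinarith [mul_pos hθ0 (mul_pos hM0 this)]
    have hcoer : Tendsto (fun y => f y - ψ (g y)) (cocompact E) atTop := by
      refine tendsto_atTop_mono (fun y => ?_)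
        (tendsto_atTop_add_const_right _ (-(θ * M)) (hf.coercive hH hq hf0))
      have := hψb (g y)
      linarith
    obtain ⟨z, hz⟩ := (hf.contDiff.continuous.sub hwC.continuous).exists_forall_le hcoer
    obtain ⟨h1, h2⟩ := IsLocalMin.sub_conditions hf.contDiff hwC
      (Eventually.of_forall hz : IsLocalMin _ z)
    rw [fderiv_comp_of_hasDerivAt hψ hg.contDiff] at h1
    set p := fderiv ℝ g z with hp
    set τ := ψ' (g z) with hτ
    have hτ0 : 0 < τ := by simp only [hτ, hψ'def]; positivity
    have hτθ : τ ≤ θ := by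
      have : Real.exp (-(g z) / M) ≤ 1 := by
        rw [Real.exp_le_one_iff]
        exact div_nonpos_of_nonpos_of_nonneg (by linarith [hg0 z]) hM0.le
      simp only [hτ, hψ'def]
      nlinarith
    have hψ''τ : ψ'' (g z) = -τ / M := rfl
    have hsum : τ * ∑ k, secondDeriv g z (a k) - τ * (S * ‖p‖ ^ 2) ≤
        ∑ k, secondDeriv f z (a k) := by
      rw [hS, Finset.sum_mul, Finset.mul_sum, Finset.mul_sum, ← Finset.sum_sub_distrib]
      refine Finset.sum_le_sum fun k _ => le_trans ?_ (h2 (a k))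
      rw [secondDeriv_comp hψ hψ' hg.contDiff, hψ''τ]
      have hpa : (p (a k)) ^ 2 ≤ ‖a k‖ ^ 2 * ‖p‖ ^ 2 := by
        rw [← mul_pow, ← sq_abs]
        refine pow_le_pow_left₀ (abs_nonneg _) ?_ 2
        rw [mul_comm]
        exact p.le_opNorm (a k)
      have h3 : τ / M * (p (a k)) ^ 2 ≤ τ * (‖a k‖ ^ 2 * ‖p‖ ^ 2) := by
        refine mul_le_mul (div_le_self hτ0.le hM) hpa (by positivity) hτ0.le
      have : -τ / M * (p (a k)) ^ 2 = -(τ / M * (p (a k)) ^ 2) := by ring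
      linarith
    have heqf := hf.eq z
    have heqg := hg.eq z
    rw [h1, hH.hom τ hτ0.le] at heqf
    have hτm : τ ^ m ≤ τ * θ ^ (m - 1) := by
      have : τ ^ m = τ * τ ^ (m - 1) := by
        rw [← Real.rpow_one_add' hτ0.le (by linarith)]; ring_nf
      rw [this]
      exact mul_le_mul_of_nonneg_left (Real.rpow_le_rpow hτ0.le hτθ (by linarith)) hτ0.le
    have hHp := hH.nonneg p
    have hquad : S * ‖p‖ ^ 2 ≤ (1 - θ ^ (m - 1)) * H p + (S + 1) * |C₁| := by
      have h4 := hC₁ p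
      have h5 : (S + 1) * ‖p‖ ^ 2 ≤
          (S + 1) * ((1 - θ ^ (m - 1)) / (S + 1) * H p + C₁) := by gcongr
      have h6 : (S + 1) * ((1 - θ ^ (m - 1)) / (S + 1) * H p + C₁)
          = (1 - θ ^ (m - 1)) * H p + (S + 1) * C₁ := by field_simp
      have h7 := le_abs_self C₁
      have h8 : (S + 1) * C₁ ≤ (S + 1) * |C₁| := by gcongr
      have h9 := sq_nonneg ‖p‖
      linarith
    have hqz : q z ≤ Q := by
      rw [hQ, le_div_iff₀ (by linarith)]
      have e1 : τ * ∑ k, secondDeriv g z (a k) = τ * lg + τ * H p - τ * q z := by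
        rw [← heqg]; ring
      have e2 : τ * (S * ‖p‖ ^ 2) ≤ τ * ((1 - θ ^ (m - 1)) * H p + (S + 1) * |C₁|) := by gcongr
      have e3 : τ ^ m * H p ≤ τ * θ ^ (m - 1) * H p := by gcongr
      have e4 : τ * q z ≤ θ * q z := mul_le_mul_of_nonneg_right hτθ (hq0 z)
      have e5 : τ * ((S + 1) * |C₁|) ≤ 1 * ((S + 1) * |C₁|) :=
        mul_le_mul_of_nonneg_right (by linarith) (by positivity)
      have e6 : -|lg| ≤ τ * lg := by
        have : |τ * lg| ≤ |lg| := by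
          rw [abs_mul, abs_of_pos hτ0]
          exact mul_le_of_le_one_left (abs_nonneg _) (by linarith)
        linarith [neg_abs_le (τ * lg)]
      have e7 := le_abs_self lf
      nlinarith
    have hgz := hGb z (hKq z hqz)
    have hψz : ψ (g z) ≤ θ * G := by
      have : M * (1 - Real.exp (-(g z) / M)) ≤ g z := by
        have h10 := Real.add_one_le_exp (-(g z) / M)
        have : M * (-(g z) / M) = -g z := by field_simp
        nlinarith
      simp only [hψdef]
      nlinarith
    have hzx := hz x
    have hfz := hf0 z
    simp only [Pi.sub_apply] at hzx
    change ψ (g x) - θ * G ≤ f x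
    linarith
  refine ⟨θ * G, fun x => ?_⟩
  -- let `M → ∞`
  have hlim : Tendsto (fun M : ℝ => θ * (g x - g x ^ 2 / M) - θ * G) atTop
      (𝓝 (θ * (g x - 0) - θ * G)) :=
    ((tendsto_const_nhds.sub (tendsto_const_nhds.div_atTop tendsto_id)).const_mul θ).sub_const _
  rw [sub_zero] at hlim
  refine le_of_tendsto hlim ?_
  filter_upwards [eventually_ge_atTop 1] with M hM
  refine le_trans ?_ (key M hM x)
  have hM0 : 0 < M := by linarith
  have hy : 0 ≤ g x / M := div_nonneg (hg0 x) hM0.le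
  have hexp : Real.exp (-(g x) / M) ≤ 1 - g x / M + (g x / M) ^ 2 := by
    have h11 : (1 + g x / M) * Real.exp (-(g x) / M) ≤ 1 := by
      have h12 := Real.add_one_le_exp (g x / M)
      have h13 : Real.exp (g x / M) * Real.exp (-(g x) / M) = 1 := by
        rw [← Real.exp_add]; simp [neg_div]
      have := Real.exp_pos (-(g x) / M)
      nlinarith
    have h14 : 1 ≤ (1 + g x / M) * (1 - g x / M + (g x / M) ^ 2) := by
      have : (1 + g x / M) * (1 - g x / M + (g x / M) ^ 2) = 1 + (g x / M) ^ 3 := by ring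
      rw [this]
      have : 0 ≤ (g x / M) ^ 3 := by positivity
      linarith
    exact le_of_mul_le_mul_left (h11.trans h14) (by linarith)
  have : g x - g x ^ 2 / M ≤ M * (1 - Real.exp (-(g x) / M)) := by
    have h15 : M * (1 - (1 - g x / M + (g x / M) ^ 2)) = g x - g x ^ 2 / M := by field_simp; ring
    rw [← h15]
    gcongr
  nlinarith

/-- At a minimum of `f - θ g` the two equations give `(1 - θ) q + θ lg ≤ lf`. -/
lemma IsErgodicSolution.exists_min_sub_mul (hm : 1 < m) (hH : IsSuperquadratic m H B)
    (hq0 : ∀ x, 0 ≤ q x) (hq : Tendsto q (cocompact E) atTop) {lf lg : ℝ} {f g : E → ℝ}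
    (hf : IsErgodicSolution a H q lf f) (hf0 : ∀ x, 0 ≤ f x)
    (hg : IsErgodicSolution a H q lg g) (hg0 : ∀ x, 0 ≤ g x)
    {θ : ℝ} (hθ0 : 0 < θ) (hθ1 : θ < 1) :
    ∃ z, (∀ x, f z - θ * g z ≤ f x - θ * g x) ∧ (1 - θ) * q z + θ * lg ≤ lf := by
  obtain ⟨C, hC⟩ := hf.exists_le_of_lt_one hm hH hq0 hq hf0 hg hg0
    (θ := (1 + θ) / 2) (by linarith) (by linarith)
  have hwC : ContDiff ℝ 2 fun y => θ * g y := contDiff_const.mul hg.contDiff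
  have hcoer : Tendsto (fun y => f y - θ * g y) (cocompact E) atTop := by
    refine tendsto_atTop_mono (fun y => ?_) (tendsto_atTop_add_const_right _ (-C)
      ((hg.coercive hH hq hg0).const_mul_atTop (show 0 < (1 - θ) / 2 by linarith)))
    have := hC y
    linarith
  obtain ⟨z, hz⟩ := Continuous.exists_forall_le
    (f := fun y => f y - θ * g y) (hf.contDiff.continuous.sub hwC.continuous) hcoer
  refine ⟨z, hz, ?_⟩
  have hψ : ∀ s : ℝ, HasDerivAt (fun s => θ * s) θ s := fun s => by
    simpa using (hasDerivAt_id s).const_mul θ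
  have hψ' : ∀ s : ℝ, HasDerivAt (fun _ : ℝ => θ) 0 s := fun s => hasDerivAt_const s θ
  obtain ⟨h1, h2⟩ := IsLocalMin.sub_conditions hf.contDiff hwC
    (show IsLocalMin (fun y => f y - θ * g y) z from Eventually.of_forall hz)
  rw [fderiv_comp_of_hasDerivAt hψ hg.contDiff] at h1
  have hsum : θ * ∑ k, secondDeriv g z (a k) ≤ ∑ k, secondDeriv f z (a k) := by
    rw [Finset.mul_sum]
    refine Finset.sum_le_sum fun k _ => le_trans (le_of_eq ?_) (h2 (a k))
    rw [secondDeriv_comp hψ hψ' hg.contDiff]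
    ring
  have heqf := hf.eq z
  have heqg := hg.eq z
  rw [h1, hH.hom θ hθ0.le] at heqf
  have hθm : θ ^ m ≤ θ := by
    simpa using Real.rpow_le_rpow_of_exponent_ge hθ0 hθ1.le hm.le
  have := mul_le_mul_of_nonneg_right hθm (hH.nonneg (fderiv ℝ g z))
  have e1 : θ * ∑ k, secondDeriv g z (a k) = θ * lg + θ * H (fderiv ℝ g z) - θ * q z := by
    rw [← heqg]; ring
  linarith

/-- Letting `θ → 1` in the previous inequality orders the constants; by symmetry, all nonnegative
solutions have the same constant. -/
lemma IsErgodicSolution.const_le (hm : 1 < m) (hH : IsSuperquadratic m H B)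
    (hq0 : ∀ x, 0 ≤ q x) (hq : Tendsto q (cocompact E) atTop) {lf lg : ℝ} {f g : E → ℝ}
    (hf : IsErgodicSolution a H q lf f) (hf0 : ∀ x, 0 ≤ f x)
    (hg : IsErgodicSolution a H q lg g) (hg0 : ∀ x, 0 ≤ g x) : lg ≤ lf := by
  have hlim : Tendsto (fun θ : ℝ => θ * lg) (𝓝[<] 1) (𝓝 (1 * lg)) :=
    ((tendsto_id.mono_left nhdsWithin_le_nhds).mul_const lg)
  rw [one_mul] at hlim
  refine le_of_tendsto hlim ?_
  filter_upwards [Ioo_mem_nhdsLT (zero_lt_one' ℝ)] with θ hθ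
  obtain ⟨z, -, hz⟩ := hf.exists_min_sub_mul hm hH hq0 hq hf0 hg hg0 hθ.1 hθ.2
  have := mul_nonneg (sub_nonneg.2 hθ.2.le) (hq0 z)
  linarith

/-- The difference of two nonnegative solutions with the same constant attains its minimum: the
minimum points of `f - θ g` stay in the compact set `{q ≤ lam}` as `θ → 1`. -/
lemma IsErgodicSolution.exists_min_sub (hm : 1 < m) (hH : IsSuperquadratic m H B)
    (hq0 : ∀ x, 0 ≤ q x) (hq : Tendsto q (cocompact E) atTop) {lam : ℝ} {f g : E → ℝ}
    (hf : IsErgodicSolution a H q lam f) (hf0 : ∀ x, 0 ≤ f x)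
    (hg : IsErgodicSolution a H q lam g) (hg0 : ∀ x, 0 ≤ g x) :
    ∃ z, ∀ x, f z - g z ≤ f x - g x := by
  obtain ⟨K, hK, hKq⟩ : ∃ K : Set E, IsCompact K ∧ ∀ x, q x ≤ lam → x ∈ K := by
    obtain ⟨K, hK, hKs⟩ := mem_cocompact.1 (hq.eventually_gt_atTop lam)
    exact ⟨K, hK, fun x hx => by
      by_contra hxK
      exact absurd (hKs hxK) (by simpa using hx)⟩
  have hmin : ∀ θ : ℝ, 0 < θ → θ < 1 → ∃ z ∈ K, ∀ x, f z - θ * g z ≤ f x - θ * g x := by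
    intro θ h0 h1
    obtain ⟨z, hz, hqz⟩ := hf.exists_min_sub_mul hm hH hq0 hq hf0 hg hg0 h0 h1
    refine ⟨z, hKq z ?_, hz⟩
    have : (1 - θ) * q z ≤ (1 - θ) * lam := by linarith
    exact le_of_mul_le_mul_left this (by linarith)
  obtain ⟨z₀, hz₀, -⟩ := hmin (1 / 2) (by norm_num) (by norm_num)
  obtain ⟨z, -, hz⟩ := hK.exists_isMinOn ⟨z₀, hz₀⟩ (f := fun y => f y - g y)
    (hf.contDiff.continuous.sub hg.contDiff.continuous).continuousOn
  refine ⟨z, fun x => ?_⟩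
  have hlim : Tendsto (fun θ : ℝ => f x - θ * g x) (𝓝[<] 1) (𝓝 (f x - 1 * g x)) :=
    tendsto_const_nhds.sub ((tendsto_id.mono_left nhdsWithin_le_nhds).mul_const (g x))
  rw [one_mul] at hlim
  refine ge_of_tendsto hlim ?_
  filter_upwards [Ioo_mem_nhdsLT (zero_lt_one' ℝ)] with θ hθ
  obtain ⟨y, hy, hyx⟩ := hmin θ hθ.1 hθ.2
  have h1 : f z - g z ≤ f y - g y := hz hy
  have h2 := hyx x
  have := mul_le_mul_of_nonneg_right hθ.2.le (hg0 y)
  linarith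

/-- By convexity of `H`, the difference `g - f` is a subsolution of the equation linearized at `f`,
`∑ₖ D²w(aₖ, aₖ) - Dw · B(Df) = 0`. Hence a function `φ` whose restriction to the set of maximum
points has a strict local minimum at `z` satisfies `Dφ(z) · B(Df(z)) ≤ ∑ₖ D²φ(z)(aₖ, aₖ)`. -/
lemma IsErgodicSolution.touching (hH : IsSuperquadratic m H B) {lam b : ℝ} {f g φ : E → ℝ}
    (hf : IsErgodicSolution a H q lam f) (hg : IsErgodicSolution a H q lam g)
    (hb : ∀ x, g x - f x ≤ b) {z : E} (hz : g z - f z = b) (hφ : ContDiff ℝ 2 φ)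
    (hpos : ∀ᶠ x in 𝓝 z, g x - f x = b → x ≠ z → φ z < φ x) :
    fderiv ℝ φ z (B (fderiv ℝ f z)) ≤ ∑ k, secondDeriv φ z (a k) := by
  by_contra hlt
  push Not at hlt
  have hcL : Continuous fun x => ∑ k, secondDeriv φ x (a k) :=
    continuous_finsetSum _ fun k _ => continuous_secondDeriv hφ (a k)
  have hcR : Continuous fun x => fderiv ℝ φ x (B (fderiv ℝ f x)) :=
    (continuous_fderiv_of_contDiff_two hφ).clm_apply
      (hH.continuous_drift.comp (continuous_fderiv_of_contDiff_two hf.contDiff))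
  have hev : ∀ᶠ x in 𝓝 z, ∑ k, secondDeriv φ x (a k) < fderiv ℝ φ x (B (fderiv ℝ f x)) :=
    (hcL.tendsto z).eventually_lt (hcR.tendsto z) hlt
  obtain ⟨ρ, hρ, hball⟩ := Metric.nhds_basis_closedBall.eventually_iff.1 (hev.and hpos)
  have hfc := hf.contDiff.continuous
  have hgc := hg.contDiff.continuous
  have hφc := hφ.continuous
  -- a small multiple of `φ` separates `g - f - b` from zero on the sphere
  obtain ⟨η, hη, hsphere⟩ : ∃ η > 0, ∀ x ∈ Metric.sphere z ρ,
      g x - f x - b - η * (φ x - φ z) < 0 := by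
    have hcomp : IsCompact (Metric.sphere z ρ ∩ {x | φ x ≤ φ z}) :=
      (isCompact_sphere z ρ).inter_right (isClosed_le hφc continuous_const)
    obtain ⟨ε, hε, hεle⟩ := hcomp.exists_forall_le' (f := fun x => b - (g x - f x)) (a := 0)
      (by fun_prop) (by
        rintro x ⟨hx, hx0⟩
        have hne : x ≠ z := Metric.ne_of_mem_sphere hx hρ.ne'
        refine sub_pos.2 (lt_of_le_of_ne (hb x) fun he => ?_)
        exact absurd ((hball (Metric.sphere_subset_closedBall hx)).2 he hne) (not_lt.2 hx0))
    obtain ⟨C, hC⟩ := (isCompact_sphere z ρ).bddBelow_image (f := fun x => φ x - φ z)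
      (by fun_prop)
    refine ⟨ε / (|C| + 1), by positivity, fun x hx => ?_⟩
    have hη : 0 < ε / (|C| + 1) := by positivity
    rcases le_or_gt (φ x) (φ z) with h | h
    · have h1 := hεle x ⟨hx, h⟩
      have h2 : C ≤ φ x - φ z := hC ⟨x, hx, rfl⟩
      have h3 : -(|C|) ≤ φ x - φ z := (neg_abs_le C).trans h2
      have h4 : ε / (|C| + 1) * -(φ x - φ z) ≤ ε / (|C| + 1) * |C| :=
        mul_le_mul_of_nonneg_left (by linarith) hη.le
      have h5 : ε / (|C| + 1) * (|C| + 1) = ε := div_mul_cancel₀ _ (by positivity)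
      linarith
    · have := hb x
      have := mul_pos hη (sub_pos.2 h)
      linarith
  obtain ⟨y, hy, hymax⟩ := (isCompact_closedBall z ρ).exists_isMinOn
    ⟨z, by simp [hρ.le]⟩ (f := fun x => (f x + η * φ x) - g x) (by fun_prop)
  have hyz : (f y + η * φ y) - g y ≤ (f z + η * φ z) - g z := hymax (by simp [hρ.le])
  have hyball : y ∈ Metric.ball z ρ := by
    rw [Metric.mem_ball]
    refine lt_of_le_of_ne hy fun he => ?_
    have := hsphere y he
    linarith
  have hloc : IsLocalMin (fun x => (f x + η * φ x) - g x) y :=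
    hymax.isLocalMin (mem_of_superset (Metric.isOpen_ball.mem_nhds hyball)
      Metric.ball_subset_closedBall)
  have hfφ : ContDiff ℝ 2 fun x => f x + η * φ x := hf.contDiff.add (contDiff_const.mul hφ)
  obtain ⟨h1, h2⟩ := IsLocalMin.sub_conditions hfφ hg.contDiff hloc
  rw [fderiv_add_const_mul hf.contDiff hφ] at h1
  have hsum : ∑ k, secondDeriv g y (a k) ≤
      ∑ k, secondDeriv f y (a k) + η * ∑ k, secondDeriv φ y (a k) := by
    rw [Finset.mul_sum, ← Finset.sum_add_distrib]
    refine Finset.sum_le_sum fun k _ => (h2 (a k)).trans_eq ?_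
    rw [secondDeriv_add_const_mul hf.contDiff hφ]
  have heqf := hf.eq y
  have heqg := hg.eq y
  have hsub := hH.subgrad (fderiv ℝ f y) (fderiv ℝ g y)
  have h3 : (fderiv ℝ g y - fderiv ℝ f y) (B (fderiv ℝ f y))
      = η * fderiv ℝ φ y (B (fderiv ℝ f y)) := by
    rw [← h1]; simp
  have h4 := (hball hy).1
  rw [h3] at hsub
  have := mul_lt_mul_of_pos_left h4 hη
  linarith

/-- A function on `ℝ` with a quadratic modulus of continuity is constant. -/
lemma eq_of_le_add_mul_sq {d : ℝ → ℝ} {C : ℝ}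
    (h : ∀ s t, d s ≤ d t + C * (s - t) ^ 2) (s t : ℝ) : d s = d t := by
  have hd : ∀ x, HasDerivAt d 0 x := by
    intro x
    rw [hasDerivAt_iff_isLittleO]
    have hO : (fun y => d y - d x - (y - x) • (0 : ℝ)) =O[𝓝 x] fun y => (y - x) ^ 2 := by
      refine Asymptotics.IsBigO.of_bound |C| (Eventually.of_forall fun y => ?_)
      have h1 := h y x
      have h2 := h x y
      have h3 : C * (y - x) ^ 2 ≤ |C| * (y - x) ^ 2 :=
        mul_le_mul_of_nonneg_right (le_abs_self C) (sq_nonneg _)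
      rw [show (x - y) ^ 2 = (y - x) ^ 2 by ring] at h2
      simp only [smul_eq_mul, mul_zero, sub_zero, Real.norm_eq_abs, abs_pow, sq_abs]
      rw [abs_le]
      constructor <;> linarith
    refine hO.trans_isLittleO ?_
    have ho : (fun y : ℝ => (y - x) ^ 2) =o[𝓝 (x - x + x)] fun y => y - x := by
      simpa using Asymptotics.isLittleO_pow_sub_sub x one_lt_two
    simpa using ho
  exact is_const_of_deriv_eq_zero (fun x => (hd x).differentiableAt) (fun x => (hd x).deriv) s t

/-- The set of maximum points of `g - f` is invariant under translation along each `aₖ`. By the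
touching condition every normal of that set is orthogonal to `aₖ`, so that the squared distance to
it along a line in direction `aₖ` has a quadratic modulus of continuity. -/
lemma IsErgodicSolution.argmax_invariant (hH : IsSuperquadratic m H B) {lam b : ℝ} {f g : E → ℝ}
    (hf : IsErgodicSolution a H q lam f) (hg : IsErgodicSolution a H q lam g)
    (hb : ∀ x, g x - f x ≤ b) {z : E} (hz : g z - f z = b) (k : ι) (s : ℝ) :
    g (z + s • a k) - f (z + s • a k) = b := by
  set Z : Set E := {x | g x - f x = b} with hZ
  have hZc : IsClosed Z :=
    isClosed_eq (hg.contDiff.continuous.sub hf.contDiff.continuous) continuous_const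
  have hnormal : ∀ p y, y ∈ Z → (∀ x ∈ Z, ‖y - p‖ ≤ ‖x - p‖) → inner ℝ (y - p) (a k) = 0 := by
    intro p y hy hyp
    by_contra hne
    -- the midpoint `p'` has `y` as its only nearest point
    set p' : E := (1 / 2 : ℝ) • (y + p) with hp'
    have hyp' : y - p' = (1 / 2 : ℝ) • (y - p) := by rw [hp']; module
    set r : E → ℝ := fun x => ‖ContinuousLinearMap.id ℝ E x - p'‖ ^ 2 with hr
    have hrC : ContDiff ℝ 2 r := contDiff_normSq_sub _ _
    have hrv : ∀ v, fderiv ℝ r y v = 2 * inner ℝ (y - p') v := fun v =>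
      fderiv_normSq_sub (ContinuousLinearMap.id ℝ E) p' y v
    have hrvv : ∀ v, secondDeriv r y v = 2 * ‖v‖ ^ 2 := fun v =>
      secondDeriv_normSq_sub (ContinuousLinearMap.id ℝ E) p' y v
    have hrpos : ∀ x ∈ Z, x ≠ y → r y < r x := by
      intro x hx hxy
      have h1 : r x - r y = (1 / 2) * (‖x - p‖ ^ 2 - ‖y - p‖ ^ 2) + (1 / 2) * ‖x - y‖ ^ 2 := by
        have e1 : x - p' = (x - y) + (1 / 2 : ℝ) • (y - p) := by rw [hp']; module
        have e2 : x - p = (x - y) + (y - p) := by module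
        simp only [hr, ContinuousLinearMap.id_apply]
        rw [hyp', e1, e2, norm_add_sq_real, norm_add_sq_real, norm_smul, inner_smul_right]
        ring
      have h2 : 0 < ‖x - y‖ := norm_pos_iff.2 (sub_ne_zero.2 hxy)
      have h3 : ‖y - p‖ ^ 2 ≤ ‖x - p‖ ^ 2 := by
        have := hyp x hx
        gcongr
      have : 0 < ‖x - y‖ ^ 2 := by positivity
      linarith
    have hyk : inner ℝ (y - p') (a k) ≠ 0 := by
      rw [hyp', inner_smul_left]
      simpa using hne
    -- a large coefficient `N` makes the second derivatives of `φ` negative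
    have hc : ∀ N : ℝ, fderiv ℝ r y (B (fderiv ℝ f y)) ≤
        ∑ j, (2 * ‖a j‖ ^ 2 - 2 * N * (2 * inner ℝ (y - p') (a j)) ^ 2) := by
      intro N
      set ψ : ℝ → ℝ := fun s => (s - r y) - N * (s - r y) ^ 2 with hψdef
      have hψ : ∀ s, HasDerivAt ψ (1 - 2 * N * (s - r y)) s := fun s => by
        have h0 := (hasDerivAt_id s).sub_const (r y)
        convert! h0.sub ((h0.pow 2).const_mul N) using 1
        simp; ring
      have hψ' : ∀ s, HasDerivAt (fun s => 1 - 2 * N * (s - r y)) (-(2 * N)) s := fun s => by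
        have h0 := (hasDerivAt_id s).sub_const (r y)
        convert! (h0.const_mul (2 * N)).const_sub 1 using 1
        simp
      have hφC : ContDiff ℝ 2 fun x => ψ (r x) := by simp only [hψdef]; fun_prop
      have hpos : ∀ᶠ x in 𝓝 y, g x - f x = b → x ≠ y → ψ (r y) < ψ (r x) := by
        have hcont : Tendsto (fun x => N * (r x - r y)) (𝓝 y) (𝓝 0) := by
          have : Continuous fun x => N * (r x - r y) := by
            have := hrC.continuous
            fun_prop
          simpa using this.tendsto y
        filter_upwards [hcont.eventually_lt_const zero_lt_one] with x hx hxZ hxy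
        have h1 := hrpos x hxZ hxy
        have h2 : ψ (r x) - ψ (r y) = (r x - r y) * (1 - N * (r x - r y)) := by
          simp only [hψdef]; ring
        rw [← sub_pos, h2]
        exact mul_pos (by linarith) (by linarith)
      have h := hf.touching hH hg hb hy hφC hpos
      rw [fderiv_comp_of_hasDerivAt hψ hrC] at h
      simp only [sub_self, mul_zero, sub_zero, one_smul] at h
      refine h.trans_eq (Finset.sum_congr rfl fun j _ => ?_)
      rw [secondDeriv_comp hψ hψ' hrC, hrv, hrvv]
      ring
    set T := ∑ j, (2 * inner ℝ (y - p') (a j)) ^ 2 with hT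
    have hTpos : 0 < T :=
      Finset.sum_pos' (fun j _ => sq_nonneg _) ⟨k, Finset.mem_univ k, by positivity⟩
    have hc' : ∀ N : ℝ, 2 * N * T ≤
        ∑ j, 2 * ‖a j‖ ^ 2 - fderiv ℝ r y (B (fderiv ℝ f y)) := by
      intro N
      have := hc N
      have e : ∑ j, 2 * N * (2 * inner ℝ (y - p') (a j)) ^ 2 = 2 * N * T := by
        rw [hT, Finset.mul_sum]
      rw [Finset.sum_sub_distrib, e] at this
      linarith
    set D := ∑ j, 2 * ‖a j‖ ^ 2 - fderiv ℝ r y (B (fderiv ℝ f y)) with hD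
    have := hc' ((D + 1) / (2 * T))
    have h5 : 2 * ((D + 1) / (2 * T)) * T = D + 1 := by field_simp
    linarith
  have hne : Z.Nonempty := ⟨z, hz⟩
  have hmod : ∀ s t : ℝ, Metric.infDist (z + s • a k) Z ^ 2 ≤
      Metric.infDist (z + t • a k) Z ^ 2 + ‖a k‖ ^ 2 * (s - t) ^ 2 := by
    intro s t
    obtain ⟨y, hy, hdy⟩ := hZc.exists_infDist_eq_dist hne (z + t • a k)
    have horth := hnormal (z + t • a k) y hy fun x hx => by
      have := Metric.infDist_le_dist_of_mem (x := z + t • a k) hx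
      rw [hdy, dist_comm, dist_eq_norm, dist_comm, dist_eq_norm] at this
      exact this
    have h1 : Metric.infDist (z + s • a k) Z ≤ ‖y - (z + s • a k)‖ := by
      have := Metric.infDist_le_dist_of_mem (x := z + s • a k) hy
      rwa [dist_comm, dist_eq_norm] at this
    have h2 : ‖y - (z + s • a k)‖ ^ 2 = ‖y - (z + t • a k)‖ ^ 2 + ‖a k‖ ^ 2 * (s - t) ^ 2 := by
      have : y - (z + s • a k) = (y - (z + t • a k)) - (s - t) • a k := by module
      rw [this, norm_sub_sq_real, inner_smul_right, horth, norm_smul, mul_pow, Real.norm_eq_abs,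
        sq_abs]
      ring
    rw [hdy, dist_comm, dist_eq_norm, ← h2]
    exact pow_le_pow_left₀ Metric.infDist_nonneg h1 2
  have h0 := eq_of_le_add_mul_sq hmod s 0
  have hz0 : Metric.infDist (z + (0 : ℝ) • a k) Z = 0 := by
    rw [zero_smul, add_zero]
    exact Metric.infDist_zero_of_mem hz
  rw [hz0] at h0
  have h1 : Metric.infDist (z + s • a k) Z = 0 := by simpa using h0
  exact (hZc.mem_iff_infDist_zero hne).2 h1

/-- If the drift `-B(Df)` at every nonzero maximum point of `g - f` points towards the origin, the
origin is a maximum point. The maximum points are invariant under the span `S` of the `aₖ`; at a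
maximum point of least norm in `Sᗮ`, the squared norm of the projection to `Sᗮ` is not affected by
the diffusion, and the drift would decrease it. -/
lemma IsErgodicSolution.zero_mem_argmax (hH : IsSuperquadratic m H B) {lam b : ℝ} {f g : E → ℝ}
    (hf : IsErgodicSolution a H q lam f) (hg : IsErgodicSolution a H q lam g)
    (hb : ∀ x, g x - f x ≤ b) {z : E} (hz : g z - f z = b)
    (hdrift : ∀ x, g x - f x = b → x ≠ 0 → 0 < inner ℝ x (B (fderiv ℝ f x))) :
    g 0 - f 0 = b := by
  set Z : Set E := {x | g x - f x = b} with hZ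
  have hZc : IsClosed Z :=
    isClosed_eq (hg.contDiff.continuous.sub hf.contDiff.continuous) continuous_const
  set S : Submodule ℝ E := Submodule.span ℝ (range a) with hS
  have hinv : ∀ v ∈ S, ∀ c : ℝ, ∀ x ∈ Z, x + c • v ∈ Z := by
    intro v hv
    induction hv using Submodule.span_induction with
    | mem v hv =>
      obtain ⟨k, rfl⟩ := hv
      intro c x hx
      exact hf.argmax_invariant hH hg hb hx k c
    | zero => intro c x hx; simpa using hx
    | add v w _ _ hv hw =>
      intro c x hx
      rw [smul_add, ← add_assoc]
      exact hw _ _ (hv _ _ hx)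
    | smul c' v _ hv =>
      intro c x hx
      rw [smul_smul]
      exact hv _ _ hx
  set P : E →L[ℝ] E := Sᗮ.starProjection with hP
  have hPZ : ∀ x ∈ Z, P x ∈ Z := by
    intro x hx
    have h1 : P x - x ∈ S := by
      have := Sᗮ.sub_starProjection_mem_orthogonal x
      rw [Submodule.orthogonal_orthogonal] at this
      rw [← neg_sub]
      exact S.neg_mem this
    simpa using hinv _ h1 1 x hx
  have hPa : ∀ k, P (a k) = 0 := fun k => by
    rw [hP, Submodule.starProjection_apply_eq_zero_iff, Submodule.orthogonal_orthogonal]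
    exact Submodule.subset_span ⟨k, rfl⟩
  obtain ⟨k₀, ⟨hk₀Z, hk₀S⟩, hk₀⟩ := (hZc.inter
    (Submodule.isClosed_orthogonal S)).exists_infDist_eq_dist
      ⟨P z, hPZ z hz, Sᗮ.starProjection_apply_mem z⟩ (0 : E)
  have hPk₀ : P k₀ = k₀ := Submodule.starProjection_eq_self_iff.2 hk₀S
  have hmin : ∀ x ∈ Z, ‖k₀‖ ≤ ‖P x‖ := by
    intro x hx
    have := Metric.infDist_le_dist_of_mem (x := (0 : E))
      (show P x ∈ Z ∩ Sᗮ from ⟨hPZ x hx, Sᗮ.starProjection_apply_mem x⟩)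
    rw [hk₀] at this
    simpa using this
  by_cases hk0 : k₀ = 0
  · rw [hk0] at hk₀Z
    exact hk₀Z
  exfalso
  have hd := hdrift k₀ hk₀Z hk0
  set v := B (fderiv ℝ f k₀) with hv
  have key : ∀ δ : ℝ, 0 < δ → 2 * inner ℝ k₀ v ≤ δ * ∑ k, 2 * ‖a k‖ ^ 2 := by
    intro δ hδ
    have hC1 : ContDiff ℝ 2 fun x => ‖P x - 0‖ ^ 2 := contDiff_normSq_sub P 0
    have hC2 : ContDiff ℝ 2 fun x => ‖ContinuousLinearMap.id ℝ E x - k₀‖ ^ 2 :=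
      contDiff_normSq_sub _ k₀
    have h := hf.touching hH hg hb hk₀Z (hC1.add (contDiff_const.mul hC2) :
      ContDiff ℝ 2 fun x => ‖P x - 0‖ ^ 2 + δ * ‖ContinuousLinearMap.id ℝ E x - k₀‖ ^ 2)
      (Eventually.of_forall fun x hx hxk => by
        have h1 : ‖k₀‖ ^ 2 ≤ ‖P x‖ ^ 2 := by
          have := hmin x hx
          gcongr
        have h2 : 0 < ‖x - k₀‖ := norm_pos_iff.2 (sub_ne_zero.2 hxk)
        have h3 : 0 < δ * ‖x - k₀‖ ^ 2 := by positivity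
        simpa [hPk₀] using by linarith)
    rw [fderiv_add_const_mul hC1 hC2] at h
    simp only [secondDeriv_add_const_mul hC1 hC2, add_apply, smul_apply, fderiv_normSq_sub,
      secondDeriv_normSq_sub, hPa, hPk₀, ← hv] at h
    have h4 : inner ℝ k₀ (P v) = inner ℝ k₀ v := by
      rw [hP, ← Submodule.inner_starProjection_left_eq_right, ← hP, hPk₀]
    simpa [h4, Finset.mul_sum] using h
  have hlim : Tendsto (fun δ : ℝ => δ * ∑ k, 2 * ‖a k‖ ^ 2) (𝓝[>] 0)
      (𝓝 (0 * ∑ k, 2 * ‖a k‖ ^ 2)) :=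
    (tendsto_id.mono_left nhdsWithin_le_nhds).mul_const _
  have := ge_of_tendsto hlim (by filter_upwards [self_mem_nhdsWithin] with δ hδ using key δ hδ)
  linarith

/-- Uniqueness for the ergodic equation, with possibly degenerate diffusion: if the drift
`-B(Df)` points towards the origin, any nonnegative solution has the same constant as `f` and
differs from `f` by a constant. -/
theorem IsErgodicSolution.unique (hm : 1 < m) (hH : IsSuperquadratic m H B)
    (hq0 : ∀ x, 0 ≤ q x) (hq : Tendsto q (cocompact E) atTop) {lf lg : ℝ} {f g : E → ℝ}
    (hf : IsErgodicSolution a H q lf f) (hf0 : ∀ x, 0 ≤ f x)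
    (hg : IsErgodicSolution a H q lg g) (hg0 : ∀ x, 0 ≤ g x)
    (hdrift : ∀ x, x ≠ 0 → 0 < inner ℝ x (B (fderiv ℝ f x))) :
    lg = lf ∧ ∀ x, g x - f x = g 0 - f 0 := by
  have hlam : lg = lf := le_antisymm (hf.const_le hm hH hq0 hq hf0 hg hg0)
    (hg.const_le hm hH hq0 hq hg0 hf hf0)
  subst hlam
  refine ⟨rfl, fun x => ?_⟩
  obtain ⟨y, hy⟩ := hf.exists_min_sub hm hH hq0 hq hf0 hg hg0
  obtain ⟨z, hz⟩ := hg.exists_min_sub hm hH hq0 hq hg0 hf hf0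
  have h1 : g 0 - f 0 = g y - f y :=
    hf.zero_mem_argmax hH hg (b := g y - f y) (fun x => by have := hy x; linarith) rfl
      fun x _ hx => hdrift x hx
  have h2 : f 0 - g 0 = f z - g z := by
    refine hg.zero_mem_argmax hH hf (b := f z - g z) (fun x => by have := hz x; linarith) rfl
      fun x hx hx0 => ?_
    have hmin : IsLocalMin (fun y => g y - f y) x := Eventually.of_forall fun y => by
      have := hz y
      simp only
      linarith
    rw [(IsLocalMin.sub_conditions hg.contDiff hf.contDiff hmin).1]
    exact hdrift x hx0
  have := hy x
  have := hz x
  linarith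

end Comparison

/-! ### Shooting for the scalar equation -/

/-- Two solutions on `[0, X]` of equations whose right-hand sides differ by a constant, with the
same initial value, are close. -/
lemma dist_le_gronwallBound_of_hasDerivWithinAt {f : ℝ → ℝ → ℝ} {K : NNReal} {X : ℝ}
    (hf : ∀ x ∈ Icc 0 X, LipschitzWith K (f x)) {lp lq : ℝ} {p q : ℝ → ℝ} (h0 : p 0 = q 0)
    (hp : ∀ x ∈ Icc 0 X, HasDerivWithinAt p (lp + f x (p x)) (Icc 0 X) x)
    (hq : ∀ x ∈ Icc 0 X, HasDerivWithinAt q (lq + f x (q x)) (Icc 0 X) x) :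
    ∀ x ∈ Icc 0 X, dist (p x) (q x) ≤ gronwallBound 0 K |lp - lq| x := by
  have hci : ∀ {r : ℝ → ℝ} {r' : ℝ} {x : ℝ}, x ∈ Ico 0 X →
      HasDerivWithinAt r r' (Icc 0 X) x → HasDerivWithinAt r r' (Ici x) x := fun hx h =>
    (h.mono (Icc_subset_Icc_left hx.1)).mono_of_mem_nhdsWithin (Icc_mem_nhdsGE hx.2)
  have := dist_le_of_approx_trajectories_ODE_of_mem (v := fun x y => lp + f x y)
    (s := fun _ => univ) (K := K) (δ := 0) (εf := 0) (εg := |lp - lq|) (f := p) (g := q)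
    (f' := fun x => lp + f x (p x)) (g' := fun x => lq + f x (q x)) (a := 0) (b := X)
    (fun x hx => by
      have := hf x (Ico_subset_Icc_self hx)
      refine LipschitzWith.lipschitzOnWith (LipschitzWith.of_dist_le_mul fun y z => ?_)
      simpa using this.dist_le_mul y z)
    (fun x hx => (hp x hx).continuousWithinAt)
    (fun x hx => hci hx (hp x (Ico_subset_Icc_self hx)))
    (fun x _ => by simp) (fun _ _ => trivial)
    (fun x hx => (hq x hx).continuousWithinAt)
    (fun x hx => hci hx (hq x (Ico_subset_Icc_self hx)))
    (fun x _ => by simp [Real.dist_eq, abs_sub_comm]) (fun _ _ => trivial) (by simp [h0])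
  simpa using this

/-- Global existence on `[0, ∞)` for a bounded Lipschitz right-hand side. -/
lemma exists_global_solution {f : ℝ → ℝ → ℝ} (hf : ∀ y, Continuous fun x => f x y)
    (hL : ∀ X : ℝ, ∃ K : NNReal, ∀ x ∈ Icc 0 X, LipschitzWith K (f x))
    (hb : ∀ X : ℝ, ∃ L : NNReal, ∀ x ∈ Icc 0 X, ∀ y, |f x y| ≤ L) :
    ∃ p : ℝ → ℝ, p 0 = 0 ∧ ∀ x, 0 ≤ x → HasDerivWithinAt p (f x (p x)) (Ici 0) x := by
  have hn : ∀ n : ℕ, ∃ α : ℝ → ℝ, α 0 = 0 ∧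
      ∀ x ∈ Icc (0 : ℝ) n, HasDerivWithinAt α (f x (α x)) (Icc (0 : ℝ) n) x := by
    intro n
    obtain ⟨K, hK⟩ := hL n
    obtain ⟨L, hLb⟩ := hb n
    have hpl : IsPicardLindelof f (⟨0, by simp⟩ : Icc (0 : ℝ) n) (0 : ℝ) (L * n) 0 L K :=
      { lipschitzOnWith := fun x hx => (hK x hx).lipschitzOnWith
        continuousOn := fun y _ => (hf y).continuousOn
        norm_le := fun x hx y _ => hLb x hx y
        mul_max_le := by simp }
    exact hpl.exists_eq_forall_mem_Icc_hasDerivWithinAt₀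
  choose α hα0 hα using hn
  have huniq : ∀ n k : ℕ, n ≤ k → ∀ x ∈ Icc (0 : ℝ) n, α n x = α k x := by
    intro n k hnk x hx
    obtain ⟨K, hK⟩ := hL n
    have hnk' : (n : ℝ) ≤ k := by exact_mod_cast hnk
    have := dist_le_gronwallBound_of_hasDerivWithinAt hK (lp := 0) (lq := 0) (p := α n) (q := α k)
      (by rw [hα0, hα0]) (fun x hx => by simpa using hα n x hx)
      (fun x hx => by
        simpa using (hα k x (Icc_subset_Icc_right hnk' hx)).mono (Icc_subset_Icc_right hnk')) x hx
    simpa [gronwallBound_ε0_δ0] using this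
  refine ⟨fun x => α ⌈x⌉₊ x, by simpa using hα0 0, fun x hx => ?_⟩
  have hxn : x < ((⌈x⌉₊ + 1 : ℕ) : ℝ) := by
    have := Nat.le_ceil x
    push_cast
    linarith
  have hpx : ∀ y ∈ Icc (0 : ℝ) ((⌈x⌉₊ + 1 : ℕ) : ℝ), α ⌈y⌉₊ y = α (⌈x⌉₊ + 1) y := fun y hy =>
    huniq _ _ (Nat.ceil_le.2 hy.2) y ⟨hy.1, Nat.le_ceil y⟩
  have h1 := hα (⌈x⌉₊ + 1) x ⟨hx, hxn.le⟩
  have h2 : HasDerivWithinAt (fun x => α ⌈x⌉₊ x) (f x (α (⌈x⌉₊ + 1) x))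
      (Icc (0 : ℝ) ((⌈x⌉₊ + 1 : ℕ) : ℝ)) x := h1.congr hpx (hpx x ⟨hx, hxn.le⟩)
  rw [← hpx x ⟨hx, hxn.le⟩] at h2
  refine h2.mono_of_mem_nhdsWithin ?_
  rw [← Ici_inter_Iic]
  exact inter_mem self_mem_nhdsWithin (mem_nhdsWithin_of_mem_nhds (Iic_mem_nhds hxn))

/-- Shooting for the scalar equation `p' = lam - x² + c |p|^m` on `[0, ∞)`. The nonlinearity is
truncated at the level `k x = ℓ (x + b)^(2/m)`, which no solution can cross downwards. The values
of `lam ≥ 0` for which `p` turns decreasing, and those for which `p` crosses `k`, form disjoint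
nonempty open sets, so some `lam` belongs to neither. -/
lemma exists_shooting_parameter {m c ℓ : ℝ} (hm : 2 < m) (hc : 0 < c) (hℓ : 0 < ℓ)
    (hcℓ : c * ℓ ^ m = 1) :
    ∃ lam b : ℝ, 0 < lam ∧ 0 < b ∧ ∃ p : ℝ → ℝ, p 0 = 0 ∧ ∀ x, 0 ≤ x →
      HasDerivWithinAt p (lam - x ^ 2 + c * p x ^ m) (Ici 0) x ∧
      0 ≤ lam - x ^ 2 + c * p x ^ m ∧ 0 ≤ p x ∧ p x ≤ ℓ * (x + b) ^ (2 / m) := by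
  have hm0 : 0 < m := by linarith
  have h2m : 0 < 2 / m := by positivity
  have h2m1 : 2 / m < 1 := by rw [div_lt_one hm0]; exact hm
  -- this shift makes the slope of the barrier `k` smaller than `b²`
  set b : ℝ := 1 + ℓ with hb
  have hb0 : 0 < b := by positivity
  set k : ℝ → ℝ := fun x => ℓ * (|x| + b) ^ (2 / m) with hk
  have hkpos : ∀ x, 0 < k x := fun x => by simp only [hk]; positivity
  have hkc : Continuous k :=
    continuous_const.mul ((continuous_abs.add continuous_const).rpow_const
      fun x => Or.inr h2m.le)
  have hkmono : ∀ x y, 0 ≤ x → x ≤ y → k x ≤ k y := by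
    intro x y hx hxy
    simp only [hk, abs_of_nonneg hx, abs_of_nonneg (hx.trans hxy)]
    gcongr
  have hkm : ∀ x, c * k x ^ m = (|x| + b) ^ 2 := by
    intro x
    have h1 : (0 : ℝ) ≤ |x| + b := by positivity
    simp only [hk]
    rw [Real.mul_rpow hℓ.le (by positivity), ← Real.rpow_mul h1, ← mul_assoc, hcℓ, one_mul,
      div_mul_cancel₀ _ hm0.ne']
    norm_num
  have hkd : ∀ x, 0 ≤ x → ∃ k', HasDerivWithinAt k k' (Ici x) x ∧ k' < b ^ 2 := by
    intro x hx
    refine ⟨ℓ * (1 * (2 / m) * (x + b) ^ (2 / m - 1)), ?_, ?_⟩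
    · have h1 : HasDerivAt (fun x : ℝ => ℓ * (x + b) ^ (2 / m))
          (ℓ * (1 * (2 / m) * (x + b) ^ (2 / m - 1))) x :=
        (((hasDerivAt_id x).add_const b).rpow_const (Or.inl (by simp; positivity))).const_mul ℓ
      refine h1.hasDerivWithinAt.congr (fun y hy => ?_) ?_
      · simp only [hk, abs_of_nonneg (hx.trans hy)]
      · simp only [hk, abs_of_nonneg hx]
    · have h1 : (x + b) ^ (2 / m - 1) ≤ 1 :=
        Real.rpow_le_one_of_one_le_of_nonpos (by linarith) (by linarith)
      have h2 : 0 ≤ (x + b) ^ (2 / m - 1) := by positivity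
      have h3 : 1 * (2 / m) * (x + b) ^ (2 / m - 1) ≤ 1 := by nlinarith
      nlinarith
  -- the truncated right-hand side without the parameter
  set F : ℝ → ℝ → ℝ := fun x y => -x ^ 2 + c * (min (max y 0) (k x)) ^ m with hF
  have hclamp0 : ∀ x y, 0 ≤ min (max y 0) (k x) := fun x y =>
    le_min (le_max_right _ _) (hkpos x).le
  have hFcont : Continuous fun z : ℝ × ℝ => F z.1 z.2 := by
    have h1 : Continuous fun z : ℝ × ℝ => (min (max z.2 0) (k z.1)) ^ m :=
      (((continuous_snd.max continuous_const).min (hkc.comp continuous_fst))).rpow_const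
        fun z => Or.inr hm0.le
    simp only [hF]
    fun_prop
  have hLip : ∀ X : ℝ, ∃ K : NNReal, ∀ x ∈ Icc 0 X, LipschitzWith K (F x) := by
    intro X
    have hrp : ContDiff ℝ 1 fun x : ℝ => x ^ m := Real.contDiff_rpow_const_of_le (by simp; linarith)
    obtain ⟨K, hK⟩ := hrp.contDiffOn.exists_lipschitzOnWith (by norm_num)
      (convex_Icc 0 (k X)) isCompact_Icc
    refine ⟨c.toNNReal * K, fun x hx => LipschitzWith.of_dist_le_mul fun y z => ?_⟩
    have hmem : ∀ y, min (max y 0) (k x) ∈ Icc 0 (k X) := fun y =>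
      ⟨hclamp0 x y, (min_le_right _ _).trans (hkmono x X hx.1 hx.2)⟩
    have h1 := hK.dist_le_mul _ (hmem y) _ (hmem z)
    have h2 : dist (min (max y 0) (k x)) (min (max z 0) (k x)) ≤ dist y z := by
      simpa using ((LipschitzWith.id.max_const (0 : ℝ)).min_const (k x)).dist_le_mul y z
    simp only [hF, Real.dist_eq] at h1 h2 ⊢
    have h3 : -x ^ 2 + c * min (max y 0) (k x) ^ m - (-x ^ 2 + c * min (max z 0) (k x) ^ m)
      = c * (min (max y 0) (k x) ^ m - min (max z 0) (k x) ^ m) := by ring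
    rw [h3, abs_mul, abs_of_pos hc]
    rw [NNReal.coe_mul, Real.coe_toNNReal c hc.le, mul_assoc]
    gcongr
    exact h1.trans (by gcongr)
  have hsol : ∀ lam : ℝ, ∃ p : ℝ → ℝ, p 0 = 0 ∧
      ∀ x, 0 ≤ x → HasDerivWithinAt p (lam + F x (p x)) (Ici 0) x := by
    intro lam
    refine exists_global_solution (f := fun x y => lam + F x y) (fun y => ?_) (fun X => ?_)
      (fun X => ?_)
    · exact continuous_const.add (hFcont.comp (continuous_id.prodMk continuous_const))
    · obtain ⟨K, hK⟩ := hLip X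
      refine ⟨K, fun x hx => LipschitzWith.of_dist_le_mul fun y z => ?_⟩
      simpa using (hK x hx).dist_le_mul y z
    · refine ⟨⟨|lam| + (X ^ 2 + c * k X ^ m), ?_⟩, fun x hx y => ?_⟩
      · have := hkpos X; positivity
      · change |lam + F x y| ≤ |lam| + (X ^ 2 + c * k X ^ m)
        have h1 : min (max y 0) (k x) ^ m ≤ k X ^ m :=
          Real.rpow_le_rpow (hclamp0 x y)
            ((min_le_right _ _).trans (hkmono x X hx.1 hx.2)) hm0.le
        have h2 : x ^ 2 ≤ X ^ 2 := by
          have := hx.1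
          have := hx.2
          gcongr
        have h3 : 0 ≤ min (max y 0) (k x) ^ m := Real.rpow_nonneg (hclamp0 x y) m
        have h4 : |F x y| ≤ X ^ 2 + c * k X ^ m := by
          have h5 := mul_le_mul_of_nonneg_left h1 hc.le
          have h6 := mul_nonneg hc.le h3
          simp only [hF, abs_le]
          constructor <;> nlinarith [sq_nonneg x, sq_nonneg X]
        exact (abs_add_le _ _).trans (by gcongr)
  choose P hP0 hP using hsol
  have hPI : ∀ lam X x, x ∈ Icc 0 X →
      HasDerivWithinAt (P lam) (lam + F x (P lam x)) (Icc 0 X) x := fun lam X x hx =>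
    (hP lam x hx.1).mono Icc_subset_Ici_self
  have hPr : ∀ lam x, 0 ≤ x → HasDerivWithinAt (P lam) (lam + F x (P lam x)) (Ici x) x :=
    fun lam x hx => (hP lam x hx).mono (Ici_subset_Ici.2 hx)
  have hPc : ∀ lam x y, 0 ≤ x → ContinuousOn (P lam) (Icc x y) := fun lam x y hx z hz =>
    ((hP lam z (hx.trans hz.1)).continuousWithinAt).mono fun w hw => hx.trans hw.1
  have hPcont : ∀ x, 0 ≤ x → Continuous fun lam => P lam x := by
    intro x hx
    obtain ⟨K, hK⟩ := hLip x
    rw [continuous_iff_continuousAt]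
    intro l₀
    rw [ContinuousAt, tendsto_iff_dist_tendsto_zero]
    have hg : Tendsto (fun l : ℝ => gronwallBound 0 K |l - l₀| x) (𝓝 l₀) (𝓝 0) := by
      have h1 : Continuous fun l : ℝ => gronwallBound 0 K |l - l₀| x :=
        (gronwallBound_continuous_ε 0 K x).comp (by fun_prop)
      simpa [gronwallBound_ε0_δ0] using h1.tendsto l₀
    refine squeeze_zero (fun _ => dist_nonneg) (fun l => ?_) hg
    exact dist_le_gronwallBound_of_hasDerivWithinAt hK (by rw [hP0, hP0])
      (hPI l x) (hPI l₀ x) x ⟨hx, le_rfl⟩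
  set S₁ : Set ℝ := {lam | ∃ x, 0 ≤ x ∧ lam + F x (P lam x) < 0} with hS₁
  set S₂ : Set ℝ := {lam | ∃ x, 0 ≤ x ∧ k x < P lam x} with hS₂
  have hS₁o : IsOpen S₁ := by
    have : S₁ = ⋃ x ∈ Ici (0 : ℝ), {lam | lam + F x (P lam x) < 0} := by
      ext; simp [hS₁]
    rw [this]
    refine isOpen_biUnion fun x hx => isOpen_lt ?_ continuous_const
    exact continuous_id.add (hFcont.comp (continuous_const.prodMk (hPcont x hx)))
  have hS₂o : IsOpen S₂ := by
    have : S₂ = ⋃ x ∈ Ici (0 : ℝ), {lam | k x < P lam x} := by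
      ext; simp [hS₂]
    rw [this]
    exact isOpen_biUnion fun x hx => isOpen_lt continuous_const (hPcont x hx)
  have hFk : ∀ x y, k x ≤ y → F x y = -x ^ 2 + (|x| + b) ^ 2 := by
    intro x y hy
    have h1 : min (max y 0) (k x) = k x := min_eq_right (hy.trans (le_max_left _ _))
    simp only [hF, h1, hkm]
  have hFkb : ∀ x y, 0 ≤ x → k x ≤ y → b ^ 2 ≤ F x y := by
    intro x y hx hy
    rw [hFk x y hy, abs_of_nonneg hx]
    nlinarith
  have habove : ∀ lam, 0 ≤ lam → ∀ x, 0 ≤ x → k x < P lam x → ∀ y, x ≤ y → k y ≤ P lam y := by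
    intro lam hlam x hx hkx y hxy
    choose! k' hk' hk'b using hkd
    refine image_le_of_deriv_right_lt_deriv_boundary' (f := k) (f' := k')
      (B := P lam) (B' := fun z => lam + F z (P lam z)) (a := x) (b := y)
      hkc.continuousOn (fun z hz => hk' z (hx.trans hz.1)) hkx.le (hPc lam x y hx)
      (fun z hz => hPr lam z (hx.trans hz.1)) (fun z hz he => ?_) ⟨hxy, le_rfl⟩
    have h1 := hFkb z (P lam z) (hx.trans hz.1) he.le
    have h2 := hk'b z (hx.trans hz.1)
    linarith
  have hdisj : ∀ lam, 0 ≤ lam → lam ∈ S₁ → lam ∈ S₂ → False := by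
    rintro lam hlam ⟨x₁, hx₁, h₁⟩ ⟨x₂, hx₂, h₂⟩
    have hx12 : x₁ < x₂ := by
      by_contra hle
      push Not at hle
      have h3 := hFkb x₁ _ hx₁ (habove lam hlam x₂ hx₂ h₂ x₁ hle)
      nlinarith
    have hlt : P lam x₁ < k x₁ := by
      by_contra hle
      push Not at hle
      have h3 := hFkb x₁ _ hx₁ hle
      nlinarith
    have hle : P lam x₂ ≤ P lam x₁ := by
      refine image_le_of_deriv_right_lt_deriv_boundary' (f := P lam)
        (f' := fun z => lam + F z (P lam z)) (B := fun _ => P lam x₁) (B' := fun _ => 0)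
        (a := x₁) (b := x₂) (hPc lam x₁ x₂ hx₁) (fun z hz => hPr lam z (hx₁.trans hz.1)) le_rfl
        continuousOn_const (fun z _ => hasDerivWithinAt_const _ _ _) (fun z hz he => ?_)
        ⟨hx12.le, le_rfl⟩
      have h3 : F z (P lam z) ≤ F x₁ (P lam x₁) := by
        have hkz := hkmono x₁ z hx₁ hz.1
        have e1 : min (max (P lam x₁) 0) (k x₁) = max (P lam x₁) 0 :=
          min_eq_left (max_le hlt.le (hkpos x₁).le)
        have e2 : min (max (P lam x₁) 0) (k z) = max (P lam x₁) 0 :=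
          min_eq_left (max_le (hlt.le.trans hkz) (hkpos z).le)
        simp only [hF, he, e1, e2]
        have h4 := hz.1
        have : x₁ ^ 2 ≤ z ^ 2 := by gcongr
        linarith
      linarith
    have := hkmono x₁ x₂ hx₁ hx12.le
    linarith
  have h0S₁ : (0 : ℝ) ∈ S₁ := by
    -- for `lam = 0` the solution is `-x³/3`
    have hneg : ∀ x : ℝ, 0 ≤ x → F x (-(x ^ 3 / 3)) = -x ^ 2 := by
      intro x hx
      have h1 : max (-(x ^ 3 / 3)) 0 = 0 := max_eq_right (by simp; positivity)
      simp [hF, h1, min_eq_left (hkpos x).le, Real.zero_rpow hm0.ne']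
    obtain ⟨K, hK⟩ := hLip 1
    have h1 := dist_le_gronwallBound_of_hasDerivWithinAt hK (lp := 0) (lq := 0) (p := P 0)
      (q := fun x => -(x ^ 3 / 3)) (by simp [hP0]) (hPI 0 1) (fun x hx => by
        rw [hneg x hx.1, zero_add]
        have : HasDerivAt (fun x : ℝ => -(x ^ 3 / 3)) (-x ^ 2) x := by
          convert! ((hasDerivAt_pow 3 x).div_const 3).neg using 1
          simp
        exact this.hasDerivWithinAt) 1 (by simp)
    have h2 : P 0 1 = -(1 ^ 3 / 3) := by simpa [gronwallBound_ε0_δ0] using h1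
    refine ⟨1, zero_le_one, ?_⟩
    rw [h2, hneg 1 zero_le_one]
    norm_num
  have hlarge : k 1 + 2 ∈ S₂ := by
    -- the slope of the solution is at least `k 1 + 1` on `[0, 1]`
    refine ⟨1, zero_le_one, ?_⟩
    have hF1 : ∀ x ∈ Icc (0 : ℝ) 1, ∀ y, -1 ≤ F x y := by
      intro x hx y
      have h1 := mul_nonneg hc.le (Real.rpow_nonneg (hclamp0 x y) m)
      have := hx.1
      have := hx.2
      simp only [hF]
      nlinarith
    have h1 : (k 1 + 1) * 1 ≤ P (k 1 + 2) 1 := by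
      refine image_le_of_deriv_right_le_deriv_boundary (f := fun x => (k 1 + 1) * x)
        (f' := fun _ => k 1 + 1) (B := P (k 1 + 2))
        (B' := fun z => k 1 + 2 + F z (P (k 1 + 2) z)) (a := 0) (b := 1)
        (by fun_prop) (fun z _ => ?_) (by simp [hP0]) (hPc _ 0 1 le_rfl)
        (fun z hz => hPr _ z hz.1) (fun z hz => ?_) ⟨zero_le_one, le_rfl⟩
      · simpa using ((hasDerivAt_id z).const_mul (k 1 + 1)).hasDerivWithinAt
      · have := hF1 z (Ico_subset_Icc_self hz) (P (k 1 + 2) z)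
        linarith
    linarith
  obtain ⟨lam, hlam, hn1, hn2⟩ : ∃ lam : ℝ, 0 ≤ lam ∧ lam ∉ S₁ ∧ lam ∉ S₂ := by
    by_contra hcon
    push Not at hcon
    obtain ⟨lam, hlam, h1, h2⟩ := (isPreconnected_Ici (a := (0 : ℝ))) S₁ S₂ hS₁o hS₂o
      (fun lam hlam => or_iff_not_imp_left.2 (hcon lam hlam)) ⟨0, self_mem_Ici, h0S₁⟩
      ⟨k 1 + 2, by have := hkpos 1; simp only [mem_Ici]; linarith, hlarge⟩
    exact hdisj lam hlam h1 h2
  have hlam0 : 0 < lam := lt_of_le_of_ne hlam fun h => hn1 (h ▸ h0S₁)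
  have hge : ∀ x, 0 ≤ x → 0 ≤ lam + F x (P lam x) := fun x hx => by
    by_contra h
    exact hn1 ⟨x, hx, not_le.1 h⟩
  have hle : ∀ x, 0 ≤ x → P lam x ≤ k x := fun x hx => by
    by_contra h
    exact hn2 ⟨x, hx, not_le.1 h⟩
  have hpos : ∀ x, 0 ≤ x → 0 ≤ P lam x := by
    intro x hx
    refine image_le_of_deriv_right_le_deriv_boundary (f := fun _ => (0 : ℝ))
      (f' := fun _ => 0) (B := P lam) (B' := fun z => lam + F z (P lam z)) (a := 0) (b := x)
      continuousOn_const (fun z _ => hasDerivWithinAt_const _ _ _) (by simp [hP0])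
      (hPc _ 0 x le_rfl) (fun z hz => hPr _ z hz.1) (fun z hz => hge z hz.1) ⟨hx, le_rfl⟩
  have hFp : ∀ x, 0 ≤ x → lam + F x (P lam x) = lam - x ^ 2 + c * P lam x ^ m := by
    intro x hx
    simp only [hF, max_eq_left (hpos x hx), min_eq_left (hle x hx)]
    ring
  refine ⟨lam, b, hlam0, hb0, P lam, hP0 lam, fun x hx => ⟨?_, ?_, hpos x hx, ?_⟩⟩
  · rw [← hFp x hx]; exact hP lam x hx
  · rw [← hFp x hx]; exact hge x hx
  · have := hle x hx
    simpa only [hk, abs_of_nonneg hx] using this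

/-! ### The power Hamiltonian -/

section PowerHamiltonian

variable {E κ : Type*} [NormedAddCommGroup E] [InnerProductSpace ℝ E] [Fintype κ]

/-- The Hamiltonian `p ↦ c ∑ⱼ |p eⱼ|^m` in the coordinates of an orthonormal basis. -/
def powHamiltonian (e : OrthonormalBasis κ ℝ E) (m c : ℝ) (p : E →L[ℝ] ℝ) : ℝ :=
  c * ∑ j, |p (e j)| ^ m

/-- The gradient of `powHamiltonian`. -/
def powDrift (e : OrthonormalBasis κ ℝ E) (m c : ℝ) (p : E →L[ℝ] ℝ) : E :=
  ∑ j, (c * (m * (|p (e j)| ^ (m - 2) * p (e j)))) • e j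

/-- The tangent line inequality for `|t|^m`, from Young's inequality. -/
lemma abs_rpow_tangent_le {m : ℝ} (hm : 2 < m) (s t : ℝ) :
    |s| ^ m + m * (|s| ^ (m - 2) * s) * (t - s) ≤ |t| ^ m := by
  have hm0 : 0 < m := by linarith
  have hm1 : 0 < m - 1 := by linarith
  have hc : m.HolderConjugate (m / (m - 1)) := by
    have := Real.HolderConjugate.conjExponent (p := m) (by linarith)
    simpa [Real.conjExponent] using this
  have hy := Real.young_inequality_of_nonneg (abs_nonneg t)
    (Real.rpow_nonneg (abs_nonneg s) (m - 1)) hc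
  rw [← Real.rpow_mul (abs_nonneg s), mul_div_cancel₀ _ hm1.ne'] at hy
  have h1 : |s| ^ (m - 2) * s * s = |s| ^ m := by
    have : |s| ^ m = |s| ^ (m - 2) * |s| ^ (2 : ℝ) := by
      rw [← Real.rpow_add' (abs_nonneg s) (by linarith)]; ring_nf
    rw [this, Real.rpow_two, sq_abs]; ring
  have h2 : |s| ^ (m - 2) * s * t ≤ |t| * |s| ^ (m - 1) := by
    have h3 : |s| ^ (m - 1) = |s| ^ (m - 2) * |s| := by
      rw [← Real.rpow_add_one' (abs_nonneg s) (by linarith)]; ring_nf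
    have h4 : s * t ≤ |s| * |t| := by rw [← abs_mul]; exact le_abs_self _
    have h5 := mul_le_mul_of_nonneg_left h4 (Real.rpow_nonneg (abs_nonneg s) (m - 2))
    rw [h3]; linarith
  have h6 : m * (|t| * |s| ^ (m - 1)) ≤ |t| ^ m + (m - 1) * |s| ^ m := by
    have h7 := mul_le_mul_of_nonneg_left hy hm0.le
    have h8 : m * (|t| ^ m / m + |s| ^ m / (m / (m - 1))) = |t| ^ m + (m - 1) * |s| ^ m := by
      field_simp
    linarith
  have h9 := mul_le_mul_of_nonneg_left h2 hm0.le
  have h10 : m * (|s| ^ (m - 2) * s) * (t - s)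
      = m * (|s| ^ (m - 2) * s * t) - m * (|s| ^ (m - 2) * s * s) := by ring
  rw [h10, h1]
  linarith

lemma exists_sq_le_mul_rpow_add {m : ℝ} (hm : 2 < m) {ε : ℝ} (hε : 0 < ε) :
    ∃ C, ∀ t : ℝ, t ^ 2 ≤ ε * |t| ^ m + C := by
  set T : ℝ := (1 / ε) ^ (1 / (m - 2)) with hT
  have hT0 : 0 < T := by positivity
  have hm2 : 0 < m - 2 := by linarith
  have hTm : T ^ (m - 2) = 1 / ε := by
    rw [hT, ← Real.rpow_mul (by positivity), one_div_mul_cancel hm2.ne', Real.rpow_one]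
  refine ⟨T ^ 2, fun t => ?_⟩
  have h0 : 0 ≤ ε * |t| ^ m := by positivity
  rcases le_total |t| T with h | h
  · have : t ^ 2 ≤ T ^ 2 := by
      rw [← sq_abs]; gcongr
    linarith
  · have h1 : 1 / ε ≤ |t| ^ (m - 2) := by
      rw [← hTm]; gcongr
    have h2 : |t| ^ m = |t| ^ (m - 2) * |t| ^ (2 : ℝ) := by
      rw [← Real.rpow_add' (abs_nonneg t) (by linarith)]; ring_nf
    have h3 : 1 ≤ ε * |t| ^ (m - 2) := by
      rw [div_le_iff₀ hε] at h1; linarith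
    have h4 := mul_le_mul_of_nonneg_right h3 (sq_nonneg t)
    rw [h2, Real.rpow_two, sq_abs]
    nlinarith [sq_nonneg T]

lemma norm_le_sum_abs_apply (e : OrthonormalBasis κ ℝ E) (p : E →L[ℝ] ℝ) :
    ‖p‖ ≤ ∑ j, |p (e j)| := by
  refine p.opNorm_le_bound (Finset.sum_nonneg fun _ _ => abs_nonneg _) fun v => ?_
  have hv : p v = ∑ j, inner ℝ (e j) v * p (e j) := by
    conv_lhs => rw [← e.sum_repr' v]
    simp [map_sum]
  rw [hv, Real.norm_eq_abs, Finset.sum_mul]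
  refine (Finset.abs_sum_le_sum_abs _ _).trans (Finset.sum_le_sum fun j _ => ?_)
  have h1 : |inner ℝ (e j) v| ≤ ‖v‖ := by
    simpa using abs_real_inner_le_norm (e j) v
  rw [abs_mul, mul_comm]
  gcongr

lemma isSuperquadratic_powHamiltonian (e : OrthonormalBasis κ ℝ E) {m c : ℝ} (hm : 2 < m)
    (hc : 0 < c) : IsSuperquadratic m (powHamiltonian e m c) (powDrift e m c) where
  continuous := by
    have : ∀ j, Continuous fun p : E →L[ℝ] ℝ => |p (e j)| ^ m := fun j =>
      (continuous_abs.comp (continuous_eval_const (e j))).rpow_const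
        fun _ => Or.inr (by linarith)
    exact continuous_const.mul (continuous_finsetSum _ fun j _ => this j)
  nonneg p := mul_nonneg hc.le (Finset.sum_nonneg fun j _ => by positivity)
  hom s hs p := by
    simp only [powHamiltonian, smul_apply, smul_eq_mul, abs_mul, abs_of_nonneg hs,
      Real.mul_rpow hs (abs_nonneg _), ← Finset.mul_sum]
    ring
  continuous_drift := by
    have h1 : ∀ j, Continuous fun p : E →L[ℝ] ℝ => p (e j) := fun j => continuous_eval_const (e j)
    have h2 : ∀ j, Continuous fun p : E →L[ℝ] ℝ => |p (e j)| ^ (m - 2) := fun j =>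
      (continuous_abs.comp (h1 j)).rpow_const fun _ => Or.inr (by linarith)
    refine continuous_finsetSum _ fun j _ => Continuous.smul ?_ continuous_const
    exact continuous_const.mul (continuous_const.mul ((h2 j).mul (h1 j)))
  subgrad p q := by
    simp only [powHamiltonian, powDrift, map_sum, map_smul, sub_apply, smul_eq_mul,
      Finset.mul_sum, ← Finset.sum_add_distrib]
    refine Finset.sum_le_sum fun j _ => ?_
    have := mul_le_mul_of_nonneg_left (abs_rpow_tangent_le hm (p (e j)) (q (e j))) hc.le
    linarith
  superquad δ hδ := by
    obtain ⟨C, hC⟩ := exists_sq_le_mul_rpow_add hm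
      (show 0 < δ * c / (Fintype.card κ + 1) by positivity)
    refine ⟨Fintype.card κ * ∑ _j : κ, C, fun p => ?_⟩
    have h1 : ‖p‖ ^ 2 ≤ (∑ j, |p (e j)|) ^ 2 := by
      have := norm_le_sum_abs_apply e p
      gcongr
    have h2 : (∑ j, |p (e j)|) ^ 2 ≤ Fintype.card κ * ∑ j, |p (e j)| ^ 2 :=
      sq_sum_le_card_mul_sum_sq
    have h3 : ∑ j, |p (e j)| ^ 2 ≤
        δ * c / (Fintype.card κ + 1) * ∑ j, |p (e j)| ^ m + ∑ _j : κ, C := by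
      rw [Finset.mul_sum, ← Finset.sum_add_distrib]
      exact Finset.sum_le_sum fun j _ => by rw [sq_abs]; exact hC _
    have hS : 0 ≤ ∑ j, |p (e j)| ^ m := Finset.sum_nonneg fun j _ => by positivity
    have h4 : (Fintype.card κ : ℝ) * (δ * c / (Fintype.card κ + 1) * ∑ j, |p (e j)| ^ m)
        ≤ δ * (c * ∑ j, |p (e j)| ^ m) := by
      have h5 : (Fintype.card κ : ℝ) / (Fintype.card κ + 1) ≤ 1 := by
        rw [div_le_one (by positivity)]; linarith
      have h6 : (Fintype.card κ : ℝ) * (δ * c / (Fintype.card κ + 1) * ∑ j, |p (e j)| ^ m)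
        = (Fintype.card κ : ℝ) / (Fintype.card κ + 1) * (δ * (c * ∑ j, |p (e j)| ^ m)) := by ring
      rw [h6]
      exact mul_le_of_le_one_left (by positivity) h5
    have h7 : (Fintype.card κ : ℝ) * ∑ j, |p (e j)| ^ 2 ≤ Fintype.card κ *
        (δ * c / (Fintype.card κ + 1) * ∑ j, |p (e j)| ^ m + ∑ _j : κ, C) := by gcongr
    simp only [powHamiltonian]
    linarith

/-- The drift `-powDrift` points towards the origin when each component of `p` has the sign of the
corresponding coordinate of `x`. -/
lemma inner_powDrift_pos (e : OrthonormalBasis κ ℝ E) {m c : ℝ} (hm : 0 < m) (hc : 0 < c)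
    {p : E →L[ℝ] ℝ} {x : E} (hx : x ≠ 0)
    (h : ∀ j, inner ℝ (e j) x ≠ 0 → 0 < p (e j) * inner ℝ (e j) x) :
    0 < inner ℝ x (powDrift e m c p) := by
  have hterm : ∀ j, inner ℝ x ((c * (m * (|p (e j)| ^ (m - 2) * p (e j)))) • e j)
      = c * m * |p (e j)| ^ (m - 2) * (p (e j) * inner ℝ (e j) x) := fun j => by
    rw [inner_smul_right, real_inner_comm]; ring
  rw [powDrift, inner_sum]
  obtain ⟨j₀, hj₀⟩ : ∃ j, inner ℝ (e j) x ≠ 0 := by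
    by_contra hcon
    push Not at hcon
    refine hx ?_
    rw [← e.sum_repr' x]
    simp [hcon]
  refine Finset.sum_pos' (fun j _ => ?_) ⟨j₀, Finset.mem_univ _, ?_⟩
  · rw [hterm]
    by_cases hj : inner ℝ (e j) x = 0
    · simp [hj]
    · have := h j hj
      positivity
  · rw [hterm]
    have := h j₀ hj₀
    have hp : p (e j₀) ≠ 0 := fun h0 => by simp [h0] at this
    have : 0 < |p (e j₀)| := abs_pos.2 hp
    positivity

end PowerHamiltonian

/-! ### The one-dimensional profile and its primitive -/

/-- An odd nondecreasing solution of `p' = -x² + lam + c |p|^m` on `ℝ` that is squeezed under the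
barrier `ℓ (x + b)^(2/m)`: the derivative of the one-dimensional corrector. -/
structure IsOddProfile (m c ℓ lam b : ℝ) (p : ℝ → ℝ) : Prop where
  lam_pos : 0 < lam
  b_pos : 0 < b
  odd : ∀ x, p (-x) = -p x
  hasDerivAt : ∀ x, HasDerivAt p (-x ^ 2 + lam + c * |p x| ^ m) x
  deriv_nonneg : ∀ x, 0 ≤ -x ^ 2 + lam + c * |p x| ^ m
  nonneg : ∀ x, 0 ≤ x → 0 ≤ p x
  le : ∀ x, 0 ≤ x → p x ≤ ℓ * (x + b) ^ (2 / m)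

/-- The profile is the odd extension of the solution found by shooting. -/
lemma exists_isOddProfile {m c ℓ : ℝ} (hm : 2 < m) (hc : 0 < c) (hℓ : 0 < ℓ)
    (hcℓ : c * ℓ ^ m = 1) : ∃ lam b p, IsOddProfile m c ℓ lam b p := by
  obtain ⟨lam, b, hlam, hb, p, hp0, hp⟩ := exists_shooting_parameter hm hc hℓ hcℓ
  have hm0 : m ≠ 0 := by linarith
  set Q : ℝ → ℝ := fun x => if 0 ≤ x then p x else -p (-x) with hQ
  have hQn : ∀ x, 0 ≤ x → Q x = p x := fun x hx => if_pos hx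
  have hodd : ∀ x, Q (-x) = -Q x := by
    intro x
    rcases lt_trichotomy x 0 with h | h | h
    · simp [hQ, h.not_ge, h.le]
    · simp [hQ, h, hp0]
    · simp [hQ, h.not_ge, h.le]
  have habs : ∀ x, |Q (-x)| = |Q x| := fun x => by rw [hodd, abs_neg]
  have hright : ∀ x, 0 ≤ x → HasDerivWithinAt Q (-x ^ 2 + lam + c * |Q x| ^ m) (Ici 0) x := by
    intro x hx
    obtain ⟨h1, -, h3, -⟩ := hp x hx
    rw [hQn x hx, abs_of_nonneg h3]
    refine HasDerivWithinAt.congr ?_ (fun y hy => hQn y hy) (hQn x hx)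
    convert! h1 using 1
    ring
  have hleft : ∀ x, x ≤ 0 → HasDerivWithinAt Q (-x ^ 2 + lam + c * |Q x| ^ m) (Iic 0) x := by
    intro x hx
    have h1 := hright (-x) (by linarith)
    rw [habs, neg_sq] at h1
    have h2 : HasDerivWithinAt (fun y => Q (-y)) ((-x ^ 2 + lam + c * |Q x| ^ m) * (-1))
        (Iic 0) x :=
      h1.comp x (hasDerivAt_neg x).hasDerivWithinAt fun y hy => by simpa using hy
    have h3 : HasDerivWithinAt Q (-((-x ^ 2 + lam + c * |Q x| ^ m) * (-1))) (Iic 0) x :=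
      h2.neg.congr (fun y _ => by simp [hodd]) (by simp [hodd])
    exact h3.congr_deriv (by ring)
  have hd : ∀ x, HasDerivAt Q (-x ^ 2 + lam + c * |Q x| ^ m) x := by
    intro x
    rcases lt_trichotomy x 0 with h | h | h
    · exact (hleft x h.le).hasDerivAt (Iic_mem_nhds h)
    · subst h
      have := (hleft 0 le_rfl).union (hright 0 le_rfl)
      rw [Iic_union_Ici] at this
      exact this.hasDerivAt univ_mem
    · exact (hright x h.le).hasDerivAt (Ici_mem_nhds h)
  have hdn : ∀ x, 0 ≤ x → 0 ≤ -x ^ 2 + lam + c * |Q x| ^ m := by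
    intro x hx
    obtain ⟨-, h2, h3, -⟩ := hp x hx
    rw [hQn x hx, abs_of_nonneg h3]
    linarith
  refine ⟨lam, b, Q, hlam, hb, hodd, hd, fun x => ?_, fun x hx => ?_, fun x hx => ?_⟩
  · rcases le_total 0 x with h | h
    · exact hdn x h
    · have := hdn (-x) (by linarith)
      rwa [habs, neg_sq] at this
  · rw [hQn x hx]; exact (hp x hx).2.2.1
  · rw [hQn x hx]; exact (hp x hx).2.2.2

lemma tendsto_add_rpow_div_rpow (r β : ℝ) :
    Tendsto (fun x : ℝ => (x + r) ^ β / x ^ β) atTop (𝓝 1) := by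
  have h1 : Tendsto (fun x : ℝ => 1 + r / x) atTop (𝓝 (1 + 0)) :=
    tendsto_const_nhds.add (tendsto_const_nhds.div_atTop tendsto_id)
  rw [add_zero] at h1
  have h2 : Tendsto (fun x : ℝ => (1 + r / x) ^ β) atTop (𝓝 (1 ^ β)) :=
    h1.rpow_const (Or.inl one_ne_zero)
  rw [Real.one_rpow] at h2
  refine h2.congr' ?_
  filter_upwards [eventually_gt_atTop 0, eventually_ge_atTop (-r)] with x hx hxr
  rw [← Real.div_rpow (by linarith) hx.le]
  congr 1
  field_simp

lemma add_rpow_le_two_rpow_mul {x y α : ℝ} (hx : 0 ≤ x) (hy : 0 ≤ y) (hα : 0 ≤ α) :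
    (x + y) ^ α ≤ 2 ^ α * (x ^ α + y ^ α) := by
  have key : ∀ u v : ℝ, 0 ≤ u → 0 ≤ v → u ≤ v → (u + v) ^ α ≤ 2 ^ α * (u ^ α + v ^ α) := by
    intro u v hu hv huv
    have h1 : (u + v) ^ α ≤ (2 * v) ^ α := by
      gcongr
      linarith
    rw [Real.mul_rpow (by norm_num) hv] at h1
    have h2 : 0 ≤ (2 : ℝ) ^ α * u ^ α := by positivity
    linarith
  rcases le_total x y with h | h
  · exact key x y hx hy h
  · rw [add_comm, add_comm (x ^ α)]
    exact key y x hy hx h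

/-- The primitive of `p` that vanishes at the origin. -/
def primitive (p : ℝ → ℝ) (x : ℝ) : ℝ := ∫ t in (0 : ℝ)..x, p t

lemma primitive_zero (p : ℝ → ℝ) : primitive p 0 = 0 := by simp [primitive]

namespace IsOddProfile

variable {m c ℓ lam b : ℝ} {p : ℝ → ℝ}

lemma continuous (h : IsOddProfile m c ℓ lam b p) : Continuous p :=
  continuous_iff_continuousAt.2 fun x => (h.hasDerivAt x).continuousAt

lemma deriv_eq (h : IsOddProfile m c ℓ lam b p) :
    deriv p = fun x => -x ^ 2 + lam + c * |p x| ^ m :=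
  funext fun x => (h.hasDerivAt x).deriv

lemma monotone (h : IsOddProfile m c ℓ lam b p) : Monotone p :=
  monotone_of_deriv_nonneg (fun x => (h.hasDerivAt x).differentiableAt) fun x => by
    rw [h.deriv_eq]; exact h.deriv_nonneg x

lemma zero (h : IsOddProfile m c ℓ lam b p) : p 0 = 0 := by
  have := h.odd 0
  rw [neg_zero] at this
  linarith

lemma abs_apply (h : IsOddProfile m c ℓ lam b p) (x : ℝ) : |p x| = p |x| := by
  rcases le_total 0 x with hx | hx
  · rw [abs_of_nonneg hx, abs_of_nonneg (h.nonneg x hx)]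
  · rw [abs_of_nonpos hx, h.odd, abs_of_nonpos]
    have := h.nonneg (-x) (by linarith)
    rw [h.odd] at this
    linarith

lemma mul_self_nonneg (h : IsOddProfile m c ℓ lam b p) (x : ℝ) : 0 ≤ p x * x := by
  rcases le_total 0 x with hx | hx
  · exact mul_nonneg (h.nonneg x hx) hx
  · have := h.nonneg (-x) (by linarith)
    rw [h.odd] at this
    nlinarith

lemma mul_self_eq_abs (h : IsOddProfile m c ℓ lam b p) (x : ℝ) : p x * x = p |x| * |x| := by
  rw [← h.abs_apply, ← abs_mul, abs_of_nonneg (h.mul_self_nonneg x)]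

/-- Dropping the nonlinear term gives a lower bound that is sharp at the origin. -/
lemma cubic_le (h : IsOddProfile m c ℓ lam b p) (hc : 0 < c) {x : ℝ} (hx : 0 ≤ x) :
    lam * x - x ^ 3 / 3 ≤ p x := by
  have hd : ∀ y, HasDerivAt (fun y => p y - (lam * y - y ^ 3 / 3)) (c * |p y| ^ m) y := fun y => by
    convert! (h.hasDerivAt y).sub (((hasDerivAt_id y).const_mul lam).sub
      ((hasDerivAt_pow 3 y).div_const 3)) using 1
    simp; ring
  have hmono : Monotone fun y => p y - (lam * y - y ^ 3 / 3) :=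
    monotone_of_deriv_nonneg (fun y => (hd y).differentiableAt) fun y => by
      rw [(hd y).deriv]; positivity
  have := hmono hx
  simp only [h.zero] at this
  norm_num at this
  linarith

lemma pos (h : IsOddProfile m c ℓ lam b p) (hc : 0 < c) {x : ℝ} (hx : 0 < x) : 0 < p x := by
  have hs : 0 < √lam := Real.sqrt_pos.2 h.lam_pos
  set y := min x (√lam) with hy
  have hy0 : 0 < y := lt_min hx hs
  have hys : y ^ 2 ≤ lam := by
    rw [← Real.sq_sqrt h.lam_pos.le]
    have := min_le_right x (√lam)
    gcongr
  have h1 := h.cubic_le hc hy0.le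
  have h2 := h.monotone (min_le_left x (√lam))
  have h3 := h.lam_pos
  have : 0 < lam * y - y ^ 3 / 3 := by
    have : lam * y - y ^ 3 / 3 = y * (lam - y ^ 2 / 3) := by ring
    rw [this]
    exact mul_pos hy0 (by linarith)
  linarith

lemma mul_self_pos (h : IsOddProfile m c ℓ lam b p) (hc : 0 < c) {x : ℝ} (hx : x ≠ 0) :
    0 < p x * x := by
  rw [h.mul_self_eq_abs]
  have : 0 < |x| := abs_pos.2 hx
  exact mul_pos (h.pos hc this) this

/-- Since `p' ≥ 0`, the profile lies above the nullcline. -/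
lemma le_apply (h : IsOddProfile m c ℓ lam b p) (hm : 2 < m) (hℓ : 0 < ℓ)
    (hcℓ : c * ℓ ^ m = 1) {x : ℝ} (hx : √lam ≤ x) : ℓ * (x - √lam) ^ (2 / m) ≤ p x := by
  have hm0 : 0 < m := by linarith
  have hs := Real.sqrt_nonneg lam
  have hx0 : 0 ≤ x := hs.trans hx
  have hxs : 0 ≤ x - √lam := sub_nonneg.2 hx
  rw [← Real.rpow_le_rpow_iff (by positivity) (h.nonneg x hx0) hm0,
    Real.mul_rpow hℓ.le (by positivity), ← Real.rpow_mul hxs, div_mul_cancel₀ _ hm0.ne',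
    Real.rpow_two]
  have h1 := h.deriv_nonneg x
  rw [abs_of_nonneg (h.nonneg x hx0)] at h1
  have h2 : (x - √lam) ^ 2 ≤ c * p x ^ m := by
    have := Real.sq_sqrt h.lam_pos.le
    nlinarith
  have h3 := mul_le_mul_of_nonneg_left h2 (Real.rpow_nonneg hℓ.le m)
  have h4 : ℓ ^ m * (c * p x ^ m) = p x ^ m := by
    rw [← mul_assoc, mul_comm (ℓ ^ m), hcℓ, one_mul]
  linarith

lemma tendsto_atTop (h : IsOddProfile m c ℓ lam b p) (hm : 2 < m) (hℓ : 0 < ℓ)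
    (hcℓ : c * ℓ ^ m = 1) : Tendsto (fun x => p x / |x| ^ (2 / m)) atTop (𝓝 ℓ) := by
  have hl := (tendsto_add_rpow_div_rpow (-√lam) (2 / m)).const_mul ℓ
  have hu := (tendsto_add_rpow_div_rpow b (2 / m)).const_mul ℓ
  rw [mul_one] at hl hu
  refine tendsto_of_tendsto_of_tendsto_of_le_of_le' hl hu ?_ ?_
  · filter_upwards [eventually_ge_atTop (√lam), eventually_gt_atTop 0] with x hx hx0
    rw [abs_of_pos hx0, ← mul_div_assoc]
    have := h.le_apply hm hℓ hcℓ hx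
    rw [sub_eq_add_neg] at this
    gcongr
  · filter_upwards [eventually_gt_atTop 0] with x hx0
    rw [abs_of_pos hx0, ← mul_div_assoc]
    have := h.le x hx0.le
    gcongr

lemma tendsto_atBot (h : IsOddProfile m c ℓ lam b p) (hm : 2 < m) (hℓ : 0 < ℓ)
    (hcℓ : c * ℓ ^ m = 1) : Tendsto (fun x => p x / |x| ^ (2 / m)) atBot (𝓝 (-ℓ)) := by
  refine (((h.tendsto_atTop hm hℓ hcℓ).comp tendsto_neg_atBot_atTop).neg).congr fun x => ?_
  simp [h.odd, neg_div]

lemma hasDerivAt_primitive (h : IsOddProfile m c ℓ lam b p) (x : ℝ) :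
    HasDerivAt (primitive p) (p x) x :=
  intervalIntegral.integral_hasDerivAt_right (h.continuous.intervalIntegrable _ _)
    (h.continuous.stronglyMeasurableAtFilter _ _) h.continuous.continuousAt

lemma deriv_primitive (h : IsOddProfile m c ℓ lam b p) : deriv (primitive p) = p :=
  funext fun x => (h.hasDerivAt_primitive x).deriv

lemma contDiff_primitive (h : IsOddProfile m c ℓ lam b p) (hm : 2 < m) :
    ContDiff ℝ 2 (primitive p) := by
  have hp : ContDiff ℝ 1 p := by
    rw [contDiff_one_iff_deriv, h.deriv_eq]
    refine ⟨fun x => (h.hasDerivAt x).differentiableAt, ?_⟩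
    have := h.continuous.abs.rpow_const (p := m) fun _ => Or.inr (by linarith)
    fun_prop
  rw [show (2 : WithTop ℕ∞) = 1 + 1 by norm_num, contDiff_succ_iff_deriv, h.deriv_primitive]
  exact ⟨fun x => (h.hasDerivAt_primitive x).differentiableAt, by simp, hp⟩

lemma primitive_abs (h : IsOddProfile m c ℓ lam b p) (x : ℝ) :
    primitive p |x| = primitive p x := by
  rcases le_total 0 x with hx | hx
  · rw [abs_of_nonneg hx]
  · rw [abs_of_nonpos hx]
    have h1 : ∫ t in (0 : ℝ)..x, p t = ∫ t in (-x)..0, p (-t) := by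
      rw [intervalIntegral.integral_comp_neg]; simp
    simp only [primitive]
    rw [h1, intervalIntegral.integral_symm]
    simp_rw [h.odd]
    simp

lemma convexOn_primitive (h : IsOddProfile m c ℓ lam b p) : ConvexOn ℝ univ (primitive p) := by
  refine Monotone.convexOn_univ_of_deriv
    (fun x => (h.hasDerivAt_primitive x).differentiableAt) ?_
  rw [h.deriv_primitive]
  exact h.monotone

/-- Comparison of `primitive p` with a function of smaller derivative. -/
lemma le_primitive_of_deriv_le (h : IsOddProfile m c ℓ lam b p) {u u' : ℝ → ℝ} {s : ℝ}
    (hu : ∀ x, s ≤ x → HasDerivAt u (u' x) x) (hle : ∀ x, s ≤ x → u' x ≤ p x)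
    (hs : u s ≤ primitive p s) {x : ℝ} (hx : s ≤ x) : u x ≤ primitive p x :=
  image_le_of_deriv_right_le_deriv_boundary (a := s) (b := x)
    (fun y hy => (hu y hy.1).continuousAt.continuousWithinAt)
    (fun y hy => (hu y hy.1).hasDerivWithinAt) hs
    (fun y _ => (h.hasDerivAt_primitive y).continuousAt.continuousWithinAt)
    (fun y _ => (h.hasDerivAt_primitive y).hasDerivWithinAt) (fun y hy => hle y hy.1) ⟨hx, le_rfl⟩

lemma primitive_le_of_le_deriv (h : IsOddProfile m c ℓ lam b p) {u u' : ℝ → ℝ} {s : ℝ}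
    (hu : ∀ x, s ≤ x → HasDerivAt u (u' x) x) (hle : ∀ x, s ≤ x → p x ≤ u' x)
    (hs : primitive p s ≤ u s) {x : ℝ} (hx : s ≤ x) : primitive p x ≤ u x :=
  image_le_of_deriv_right_le_deriv_boundary (a := s) (b := x)
    (fun y _ => (h.hasDerivAt_primitive y).continuousAt.continuousWithinAt)
    (fun y _ => (h.hasDerivAt_primitive y).hasDerivWithinAt) hs
    (fun y hy => (hu y hy.1).continuousAt.continuousWithinAt)
    (fun y hy => (hu y hy.1).hasDerivWithinAt) (fun y hy => hle y hy.1) ⟨hx, le_rfl⟩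

lemma primitive_nonneg (h : IsOddProfile m c ℓ lam b p) (x : ℝ) : 0 ≤ primitive p x := by
  rw [← h.primitive_abs]
  exact h.le_primitive_of_deriv_le (u := fun _ => 0) (u' := fun _ => 0) (s := 0)
    (fun x _ => hasDerivAt_const x 0) (fun x hx => h.nonneg x hx) (by simp [primitive_zero])
    (abs_nonneg x)

lemma quadratic_le_primitive (h : IsOddProfile m c ℓ lam b p) (hc : 0 < c) {x : ℝ} (hx : 0 ≤ x) :
    lam * x ^ 2 / 2 - x ^ 4 / 12 ≤ primitive p x := by
  refine h.le_primitive_of_deriv_le (u := fun x => lam * x ^ 2 / 2 - x ^ 4 / 12)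
    (u' := fun x => lam * x - x ^ 3 / 3) (s := 0) (fun x _ => ?_) (fun x hx => h.cubic_le hc hx)
    (by simp [primitive_zero]) hx
  convert! (((hasDerivAt_pow 2 x).const_mul lam).div_const 2).sub
    ((hasDerivAt_pow 4 x).div_const 12) using 1
  simp; ring

lemma quadratic_le_primitive_of_sq_le (h : IsOddProfile m c ℓ lam b p) (hc : 0 < c) {x : ℝ}
    (hx : 0 ≤ x) (hxl : x ^ 2 ≤ lam) : lam / 4 * x ^ 2 ≤ primitive p x := by
  have h1 := h.quadratic_le_primitive hc hx
  have h2 := mul_le_mul_of_nonneg_right hxl (sq_nonneg x)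
  have h3 := mul_nonneg h.lam_pos.le (sq_nonneg x)
  nlinarith

lemma primitive_pos (h : IsOddProfile m c ℓ lam b p) (hc : 0 < c) {x : ℝ} (hx : x ≠ 0) :
    0 < primitive p x := by
  rw [← h.primitive_abs]
  have hx0 : 0 < |x| := abs_pos.2 hx
  have hs : 0 < √lam := Real.sqrt_pos.2 h.lam_pos
  set y := min |x| (√lam) with hy
  have hy0 : 0 < y := lt_min hx0 hs
  have hys : y ^ 2 ≤ lam := by
    rw [← Real.sq_sqrt h.lam_pos.le]
    have := min_le_right |x| (√lam)
    gcongr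
  have h1 := h.quadratic_le_primitive_of_sq_le hc hy0.le hys
  have h2 : primitive p y ≤ primitive p |x| :=
    h.le_primitive_of_deriv_le (u := fun _ => primitive p y) (u' := fun _ => 0) (s := y)
      (fun x _ => hasDerivAt_const x _) (fun x hx => h.nonneg x (hy0.le.trans hx)) le_rfl
      (min_le_left _ _)
  have := h.lam_pos
  have : 0 < lam / 4 * y ^ 2 := by positivity
  linarith

lemma hasDerivAt_rpow_barrier (hm : 2 < m) (r x : ℝ) :
    HasDerivAt (fun x => ℓ / (1 + 2 / m) * (x + r) ^ (1 + 2 / m)) (ℓ * (x + r) ^ (2 / m)) x := by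
  have hm0 : 0 < m := by linarith
  have h2m : 0 < 2 / m := by positivity
  have := (((hasDerivAt_id x).add_const r).rpow_const (p := 1 + 2 / m)
    (Or.inr (by linarith))).const_mul (ℓ / (1 + 2 / m))
  convert! this using 1
  simp
  field_simp

lemma primitive_le (h : IsOddProfile m c ℓ lam b p) (hm : 2 < m) (hℓ : 0 < ℓ) {x : ℝ}
    (hx : 0 ≤ x) : primitive p x ≤ ℓ / (1 + 2 / m) * (x + b) ^ (1 + 2 / m) := by
  have hb := h.b_pos
  have hm0 : 0 < m := by linarith
  refine h.primitive_le_of_le_deriv (s := 0)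
    (fun x _ => hasDerivAt_rpow_barrier hm b x) h.le ?_ hx
  rw [primitive_zero]
  positivity

lemma le_primitive (h : IsOddProfile m c ℓ lam b p) (hm : 2 < m) (hℓ : 0 < ℓ)
    (hcℓ : c * ℓ ^ m = 1) {x : ℝ} (hx : √lam ≤ x) :
    ℓ / (1 + 2 / m) * (x - √lam) ^ (1 + 2 / m) ≤ primitive p x := by
  have hm0 : 0 < m := by linarith
  simp_rw [sub_eq_add_neg]
  refine h.le_primitive_of_deriv_le (s := √lam)
    (fun x _ => hasDerivAt_rpow_barrier (ℓ := ℓ) hm (-√lam) x)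
    (fun x hx => ?_) ?_ hx
  · rw [← sub_eq_add_neg]
    exact h.le_apply hm hℓ hcℓ hx
  · have : 1 + 2 / m ≠ 0 := by positivity
    simp [Real.zero_rpow this, h.primitive_nonneg]

lemma tendsto_primitive (h : IsOddProfile m c ℓ lam b p) (hm : 2 < m) (hℓ : 0 < ℓ)
    (hcℓ : c * ℓ ^ m = 1) :
    Tendsto (fun x => primitive p x / |x| ^ (1 + 2 / m)) (cocompact ℝ)
      (𝓝 (ℓ / (1 + 2 / m))) := by
  have hl := (tendsto_add_rpow_div_rpow (-√lam) (1 + 2 / m)).const_mul (ℓ / (1 + 2 / m))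
  have hu := (tendsto_add_rpow_div_rpow b (1 + 2 / m)).const_mul (ℓ / (1 + 2 / m))
  rw [mul_one] at hl hu
  have hmain : Tendsto (fun x => primitive p x / x ^ (1 + 2 / m)) atTop
      (𝓝 (ℓ / (1 + 2 / m))) := by
    refine tendsto_of_tendsto_of_tendsto_of_le_of_le' hl hu ?_ ?_
    · filter_upwards [eventually_ge_atTop (√lam), eventually_gt_atTop 0] with x hx hx0
      rw [← mul_div_assoc]
      have := h.le_primitive hm hℓ hcℓ hx
      rw [sub_eq_add_neg] at this
      gcongr
    · filter_upwards [eventually_gt_atTop 0] with x hx0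
      rw [← mul_div_assoc]
      have := h.primitive_le hm hℓ hx0.le
      gcongr
  have := hmain.comp (tendsto_norm_cocompact_atTop (E := ℝ))
  refine this.congr fun x => ?_
  simp [h.primitive_abs]

lemma exists_primitive_le (h : IsOddProfile m c ℓ lam b p) (hm : 2 < m) (hℓ : 0 < ℓ) :
    ∃ C, 0 < C ∧ ∀ x, primitive p x ≤ C * (1 + |x| ^ (1 + 2 / m)) := by
  have hm0 : 0 < m := by linarith
  have hb := h.b_pos
  refine ⟨ℓ / (1 + 2 / m) * (2 ^ (1 + 2 / m) * (1 + b ^ (1 + 2 / m))), by positivity,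
    fun x => ?_⟩
  rw [← h.primitive_abs]
  refine (h.primitive_le hm hℓ (abs_nonneg x)).trans ?_
  have h2 := add_rpow_le_two_rpow_mul (abs_nonneg x) hb.le (show 0 ≤ 1 + 2 / m by positivity)
  have h3 : 0 ≤ |x| ^ (1 + 2 / m) := by positivity
  have h4 : 0 ≤ b ^ (1 + 2 / m) := by positivity
  rw [mul_assoc]
  refine mul_le_mul_of_nonneg_left (h2.trans ?_) (by positivity)
  rw [mul_assoc]
  refine mul_le_mul_of_nonneg_left ?_ (by positivity)
  nlinarith [mul_nonneg h3 h4]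

lemma exists_le_primitive (h : IsOddProfile m c ℓ lam b p) (hm : 2 < m) (hℓ : 0 < ℓ)
    (hcℓ : c * ℓ ^ m = 1) :
    ∃ C₀ C, 0 < C₀ ∧ 0 < C ∧ ∀ x, C₀ * |x| ^ (1 + 2 / m) - C ≤ primitive p x := by
  have hm0 : 0 < m := by linarith
  have hs : 0 < √lam := Real.sqrt_pos.2 h.lam_pos
  set α := 1 + 2 / m with hα
  have hα0 : 0 < α := by positivity
  refine ⟨ℓ / α * (1 / 2) ^ α, ℓ / α * (1 / 2) ^ α * (2 * √lam) ^ α, by positivity, by positivity,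
    fun x => ?_⟩
  rw [← h.primitive_abs]
  rcases le_total |x| (2 * √lam) with hx | hx
  · have h1 : |x| ^ α ≤ (2 * √lam) ^ α := by gcongr
    have h2 := mul_le_mul_of_nonneg_left h1 (show 0 ≤ ℓ / α * (1 / 2) ^ α by positivity)
    have h3 := h.primitive_nonneg |x|
    linarith
  · have h1 := h.le_primitive hm hℓ hcℓ (x := |x|) (by linarith)
    have h2 : (1 / 2 * |x|) ^ α ≤ (|x| - √lam) ^ α := by
      gcongr
      linarith
    rw [Real.mul_rpow (by norm_num) (abs_nonneg x)] at h2
    have h3 := mul_le_mul_of_nonneg_left h2 (show 0 ≤ ℓ / α by positivity)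
    have h4 : 0 ≤ ℓ / α * (1 / 2) ^ α * (2 * √lam) ^ α := by positivity
    linarith

lemma exists_abs_le_rpow (h : IsOddProfile m c ℓ lam b p) (hm : 2 < m) (hℓ : 0 < ℓ) :
    ∃ C, 0 < C ∧ ∀ x, |p x| ≤ C * (1 + |x| ^ (2 / m)) := by
  have hm0 : 0 < m := by linarith
  have hb := h.b_pos
  refine ⟨ℓ * (1 + b ^ (2 / m)), by positivity, fun x => ?_⟩
  rw [h.abs_apply]
  refine (h.le |x| (abs_nonneg x)).trans ?_
  have h1 := Real.rpow_add_le_add_rpow (abs_nonneg x) hb.le (show 0 ≤ 2 / m by positivity)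
    (by rw [div_le_one hm0]; exact hm.le)
  have h3 : 0 ≤ |x| ^ (2 / m) := by positivity
  have h4 : 0 ≤ b ^ (2 / m) := by positivity
  rw [mul_assoc]
  refine mul_le_mul_of_nonneg_left (h1.trans ?_) hℓ.le
  nlinarith [mul_nonneg h3 h4]

lemma exists_abs_le_abs (h : IsOddProfile m c ℓ lam b p) (hm : 2 < m) (hc : 0 < c) (hℓ : 0 < ℓ) :
    ∃ C, 0 < C ∧ ∀ x, |p x| ≤ C * |x| := by
  have hm0 : 0 < m := by linarith
  obtain ⟨C, hC0, hC⟩ := h.exists_abs_le_rpow hm hℓ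
  have hM : 0 < lam + c * p 1 ^ m := by
    have := h.nonneg 1 zero_le_one
    have := h.lam_pos
    positivity
  refine ⟨max (lam + c * p 1 ^ m) (2 * C), lt_max_of_lt_left hM, fun x => ?_⟩
  rcases le_total |x| 1 with hx | hx
  · have h1 : p |x| ≤ (lam + c * p 1 ^ m) * |x| := by
      refine image_le_of_deriv_right_le_deriv_boundary (a := 0) (b := |x|)
        (B := fun y => (lam + c * p 1 ^ m) * y) (B' := fun _ => lam + c * p 1 ^ m)
        h.continuous.continuousOn (fun y _ => (h.hasDerivAt y).hasDerivWithinAt)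
        (by simp [h.zero]) (by fun_prop) (fun y _ => ?_) (fun y hy => ?_) ⟨abs_nonneg x, le_rfl⟩
      · simpa using ((hasDerivAt_id y).const_mul (lam + c * p 1 ^ m)).hasDerivWithinAt
      · have h2 : |p y| ≤ p 1 := by
          rw [abs_of_nonneg (h.nonneg y hy.1)]
          exact h.monotone (hy.2.le.trans hx)
        have h3 : |p y| ^ m ≤ p 1 ^ m := by gcongr
        nlinarith [sq_nonneg y]
    rw [h.abs_apply]
    exact h1.trans (mul_le_mul_of_nonneg_right (le_max_left _ _) (abs_nonneg x))
  · have h1 : |x| ^ (2 / m) ≤ |x| := by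
      have := Real.rpow_le_rpow_of_exponent_le hx (show 2 / m ≤ 1 by
        rw [div_le_one hm0]; exact hm.le)
      simpa using this
    have h2 : C * (1 + |x| ^ (2 / m)) ≤ C * (|x| + |x|) := by gcongr
    have h3 : 2 * C * |x| ≤ max (lam + c * p 1 ^ m) (2 * C) * |x| :=
      mul_le_mul_of_nonneg_right (le_max_right _ _) (abs_nonneg x)
    linarith [hC x]

/-- The elasticity `x φ'(x) / φ(x)` is bounded: near the origin both sides are quadratic, and at
infinity both have the growth `|x|^(1 + 2/m)`. -/
lemma exists_mul_self_le_primitive (h : IsOddProfile m c ℓ lam b p) (hm : 2 < m) (hc : 0 < c)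
    (hℓ : 0 < ℓ) (hcℓ : c * ℓ ^ m = 1) :
    ∃ K, 0 < K ∧ ∀ x, p x * x ≤ K * primitive p x := by
  have hm0 : 0 < m := by linarith
  have hl := h.lam_pos
  have hs : 0 < √lam := Real.sqrt_pos.2 hl
  obtain ⟨C₁, hC₁0, hC₁⟩ := h.exists_abs_le_abs hm hc hℓ
  obtain ⟨C₂, hC₂0, hC₂⟩ := h.exists_abs_le_rpow hm hℓ
  obtain ⟨c₀, C₃, hc₀, hC₃, hlow⟩ := h.exists_le_primitive hm hℓ hcℓ
  have hφs : 0 < primitive p (√lam) := h.primitive_pos hc hs.ne'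
  set D := C₂ * (2 * ((1 + C₃) / c₀ + 1)) with hD
  have hD0 : 0 < D := by positivity
  refine ⟨max (4 * C₁ / lam) (D * (1 / primitive p (√lam) + 1)),
    lt_max_of_lt_left (by positivity), fun x => ?_⟩
  rw [h.mul_self_eq_abs, ← h.primitive_abs x]
  have hφ0 := h.primitive_nonneg |x|
  rcases le_total |x| (√lam) with hx | hx
  · have h1 : |x| ^ 2 ≤ lam := by
      rw [← Real.sq_sqrt hl.le]; gcongr
    have h2 := h.quadratic_le_primitive_of_sq_le hc (abs_nonneg x) h1
    have h3 : p |x| ≤ C₁ * |x| := by rw [← h.abs_apply]; exact hC₁ x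
    have h4 := mul_le_mul_of_nonneg_right h3 (abs_nonneg x)
    have h5 := mul_le_mul_of_nonneg_left h2 (show 0 ≤ 4 * C₁ / lam by positivity)
    have h6 : 4 * C₁ / lam * (lam / 4 * |x| ^ 2) = C₁ * |x| * |x| := by field_simp
    have h7 := mul_le_mul_of_nonneg_right
      (le_max_left (4 * C₁ / lam) (D * (1 / primitive p (√lam) + 1))) hφ0
    linarith
  · have hx0 : 0 < |x| := hs.trans_le hx
    have h1 : p |x| ≤ C₂ * (1 + |x| ^ (2 / m)) := by rw [← h.abs_apply]; exact hC₂ x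
    have hα : |x| ^ (1 + 2 / m) = |x| * |x| ^ (2 / m) := by
      rw [Real.rpow_add hx0, Real.rpow_one]
    have h2 : |x| ≤ 1 + |x| ^ (1 + 2 / m) := by
      rcases le_total |x| 1 with h1 | h1
      · have : 0 ≤ |x| ^ (1 + 2 / m) := by positivity
        linarith
      · have := Real.rpow_le_rpow_of_exponent_le h1 (show 1 ≤ 1 + 2 / m by
          have : 0 < 2 / m := by positivity
          linarith)
        rw [Real.rpow_one] at this
        linarith
    have h3 : p |x| * |x| ≤ C₂ * (2 * (|x| ^ (1 + 2 / m) + 1)) := by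
      have h4 := mul_le_mul_of_nonneg_right h1 (abs_nonneg x)
      have h5 : C₂ * (1 + |x| ^ (2 / m)) * |x| = C₂ * (|x| + |x| ^ (1 + 2 / m)) := by
        rw [hα]; ring
      have h6 : C₂ * (|x| + |x| ^ (1 + 2 / m)) ≤ C₂ * (2 * (|x| ^ (1 + 2 / m) + 1)) := by
        gcongr
        have : 0 ≤ |x| ^ (1 + 2 / m) := by positivity
        linarith
      linarith
    have h4 : |x| ^ (1 + 2 / m) + 1 ≤ ((1 + C₃) / c₀ + 1) * (primitive p |x| + 1) := by
      have h5 := hlow x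
      rw [← h.primitive_abs] at h5
      have h6 : |x| ^ (1 + 2 / m) ≤ (primitive p |x| + C₃) / c₀ := by
        rw [le_div_iff₀ hc₀]; linarith
      have h7 : (primitive p |x| + C₃) / c₀ ≤ (1 + C₃) / c₀ * (primitive p |x| + 1) := by
        rw [div_mul_eq_mul_div]
        gcongr
        nlinarith [mul_nonneg hC₃.le hφ0]
      have h8 : 1 ≤ primitive p |x| + 1 := by linarith
      linarith
    have h5 : p |x| * |x| ≤ D * (primitive p |x| + 1) := by
      refine h3.trans ?_
      rw [hD, mul_assoc, mul_assoc]
      gcongr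
    have h6 : 1 ≤ 1 / primitive p (√lam) * primitive p |x| := by
      rw [div_mul_eq_mul_div, one_mul, one_le_div hφs]
      exact h.le_primitive_of_deriv_le (u := fun _ => primitive p (√lam)) (u' := fun _ => 0)
        (s := √lam) (fun x _ => hasDerivAt_const x _) (fun x hx => h.nonneg x (hs.le.trans hx))
        le_rfl hx
    have h7 := mul_le_mul_of_nonneg_right
      (le_max_right (4 * C₁ / lam) (D * (1 / primitive p (√lam) + 1))) hφ0
    have h8 : D * (primitive p |x| + 1) ≤ D * (1 / primitive p (√lam) + 1) * primitive p |x| := by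
      rw [mul_assoc D]
      refine mul_le_mul_of_nonneg_left ?_ hD0.le
      linarith
    linarith

end IsOddProfile

/-! ### Uniqueness of the one-dimensional corrector -/

/-- The coefficient of `|φ'|^m` and the limit of `φ' / |x|^(2/m)` are related by `c ℓ^m = 1`. -/
lemma corrector_coefficients {m : ℝ} (hm : 2 < m) :
    0 < m ^ (-m) / (m - 1) ^ (1 - m) ∧ 0 < m * (m - 1) ^ (1 / m - 1) ∧
      m ^ (-m) / (m - 1) ^ (1 - m) * (m * (m - 1) ^ (1 / m - 1)) ^ m = 1 := by
  have hm0 : 0 < m := by linarith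
  have hm1 : 0 < m - 1 := by linarith
  refine ⟨by positivity, by positivity, ?_⟩
  rw [Real.mul_rpow hm0.le (by positivity), ← Real.rpow_mul hm1.le,
    show (1 / m - 1) * m = 1 - m by field_simp, Real.rpow_neg hm0.le]
  have h1 : m ^ m ≠ 0 := by positivity
  have h2 : (m - 1) ^ (1 - m) ≠ 0 := by positivity
  field_simp

lemma IsOddProfile.isOneDimCorrector {m lam b : ℝ} {p : ℝ → ℝ} (hm : 2 < m)
    (h : IsOddProfile m (m ^ (-m) / (m - 1) ^ (1 - m)) (m * (m - 1) ^ (1 / m - 1)) lam b p) :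
    IsOneDimCorrector m lam (primitive p) := by
  obtain ⟨hc, hℓ, hcℓ⟩ := corrector_coefficients hm
  refine ⟨h.contDiff_primitive hm, fun x => ?_, primitive_zero p, ?_, ?_⟩
  · rw [h.deriv_primitive, h.deriv_eq]
  · rw [h.deriv_primitive]; exact h.tendsto_atTop hm hℓ hcℓ
  · rw [h.deriv_primitive]; exact h.tendsto_atBot hm hℓ hcℓ

/-- A one-dimensional corrector is bounded below: its derivative has the sign of `x` for large
`|x|`. -/
lemma IsOneDimCorrector.exists_le {m lam : ℝ} {φ : ℝ → ℝ} (hm : 2 < m)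
    (h : IsOneDimCorrector m lam φ) : ∃ C, ∀ x, C ≤ φ x := by
  obtain ⟨-, hℓ, -⟩ := corrector_coefficients hm
  have hdiff : Differentiable ℝ φ := h.contDiff.differentiable (by norm_num)
  have htop : ∀ᶠ x in atTop, 0 < deriv φ x := by
    filter_upwards [h.tendsto_atTop.eventually_const_lt hℓ, eventually_gt_atTop 0] with x hx hx0
    have : 0 < |x| ^ (2 / m) := by have := abs_pos.2 hx0.ne'; positivity
    exact (div_pos_iff_of_pos_right this).1 hx
  have hbot : ∀ᶠ x in atBot, deriv φ x < 0 := by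
    filter_upwards [h.tendsto_atBot.eventually_lt_const (neg_neg_of_pos hℓ),
      eventually_lt_atBot 0] with x hx hx0
    have : 0 < |x| ^ (2 / m) := by have := abs_pos.2 hx0.ne; positivity
    by_contra hcon
    exact absurd (div_nonneg (not_lt.1 hcon) this.le) (not_le.2 hx)
  obtain ⟨X, hX⟩ := eventually_atTop.1 htop
  obtain ⟨Y, hY⟩ := eventually_atBot.1 hbot
  obtain ⟨C, hC⟩ := (isCompact_Icc (a := min X Y) (b := max X Y)).bddBelow_image
    hdiff.continuous.continuousOn
  have hin : ∀ x, min X Y ≤ x → x ≤ max X Y → C ≤ φ x := fun x h1 h2 => hC ⟨x, ⟨h1, h2⟩, rfl⟩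
  have hmono : MonotoneOn φ (Ici (max X Y)) :=
    monotoneOn_of_deriv_nonneg (convex_Ici _) hdiff.continuous.continuousOn
      hdiff.differentiableOn fun x hx => by
        rw [interior_Ici] at hx
        exact (hX x ((le_max_left X Y).trans (le_of_lt hx))).le
  have hanti : AntitoneOn φ (Iic (min X Y)) :=
    antitoneOn_of_deriv_nonpos (convex_Iic _) hdiff.continuous.continuousOn
      hdiff.differentiableOn fun x hx => by
        rw [interior_Iic] at hx
        exact (hY x ((le_of_lt hx).trans (min_le_right X Y))).le
  refine ⟨C, fun x => ?_⟩
  rcases le_total x (min X Y) with h1 | h1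
  · exact (hin _ le_rfl min_le_max).trans (hanti h1 self_mem_Iic h1)
  · rcases le_total x (max X Y) with h2 | h2
    · exact hin x h1 h2
    · exact (hin _ min_le_max le_rfl).trans (hmono self_mem_Ici h2 h2)

lemma secondDeriv_one {f : ℝ → ℝ} (hf : ContDiff ℝ 2 f) (x : ℝ) :
    secondDeriv f x 1 = deriv (deriv f) x := by
  have h0 : HasFDerivAt (fderiv ℝ f) (fderiv ℝ (fderiv ℝ f) x) x :=
    (differentiable_fderiv hf x).hasFDerivAt
  have h1 : HasDerivAt (fderiv ℝ f) (fderiv ℝ (fderiv ℝ f) x 1) x := h0.hasDerivAt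
  have h2 : HasDerivAt (fun y => fderiv ℝ f y 1)
      (fderiv ℝ (fderiv ℝ f) x 1 1 + fderiv ℝ f x 0) x := h1.clm_apply (hasDerivAt_const x (1 : ℝ))
  have h3 : (fun y => fderiv ℝ f y 1) = deriv f := by ext y; simp
  rw [h3, map_zero, add_zero] at h2
  exact h2.deriv.symm

/-- Adding a constant, the one-dimensional corrector is an ergodic solution on `ℝ`. -/
lemma IsOneDimCorrector.isErgodicSolution {m lam : ℝ} {φ : ℝ → ℝ} (h : IsOneDimCorrector m lam φ)
    (C : ℝ) :
    IsErgodicSolution (fun _ : Unit => (1 : ℝ))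
      (powHamiltonian (OrthonormalBasis.singleton Unit ℝ) m (m ^ (-m) / (m - 1) ^ (1 - m)))
      (fun x => x ^ 2) lam (fun x => φ x + C) := by
  have hC : ContDiff ℝ 2 fun x => φ x + C := h.contDiff.add contDiff_const
  refine ⟨hC, fun x => ?_⟩
  have hd : deriv (fun x => φ x + C) = deriv φ := by ext y; simp
  simp only [Finset.univ_unique, Finset.sum_singleton, powHamiltonian,
    OrthonormalBasis.singleton_apply, secondDeriv_one hC, hd, fderiv_eq_deriv_mul, mul_one]
  rw [h.ode]
  ring

/-- Uniqueness of the one-dimensional corrector: after adding a constant every corrector is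
nonnegative, so the comparison theorem for ergodic equations applies on `ℝ`. -/
lemma IsOneDimCorrector.eq_primitive {m lam lam' b : ℝ} {p φ : ℝ → ℝ} (hm : 2 < m)
    (h : IsOddProfile m (m ^ (-m) / (m - 1) ^ (1 - m)) (m * (m - 1) ^ (1 / m - 1)) lam b p)
    (hφ : IsOneDimCorrector m lam' φ) : lam' = lam ∧ φ = primitive p := by
  obtain ⟨hc, hℓ, hcℓ⟩ := corrector_coefficients hm
  obtain ⟨C, hC⟩ := hφ.exists_le hm
  have hf := (h.isOneDimCorrector hm).isErgodicSolution 0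
  have hg := hφ.isErgodicSolution (-C)
  have hq : Tendsto (fun x : ℝ => x ^ 2) (cocompact ℝ) atTop := by
    have := (tendsto_pow_atTop (two_ne_zero)).comp (tendsto_norm_cocompact_atTop (E := ℝ))
    refine this.congr fun x => ?_
    simp
  obtain ⟨h1, h2⟩ := hf.unique (by linarith)
    (isSuperquadratic_powHamiltonian (OrthonormalBasis.singleton Unit ℝ) hm hc)
    (fun x => sq_nonneg x) hq (fun x => by simpa using h.primitive_nonneg x) hg
    (fun x => by linarith [hC x]) (fun x hx => by
      refine inner_powDrift_pos _ (by linarith) hc hx fun j hj => ?_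
      have := h.mul_self_pos hc hx
      simpa [h.deriv_primitive] using this)
  refine ⟨h1, funext fun x => ?_⟩
  have := h2 x
  rw [hφ.zero, primitive_zero] at this
  linarith

/-! ### The reduced equation, its coefficients and separable functions -/

section Bridge

variable {d : ℕ}

lemma hessian_apply {f : EuclideanSpace ℝ (Fin d) → ℝ} (hf : ContDiff ℝ 2 f)
    (x : EuclideanSpace ℝ (Fin d)) (i j : Fin d) :
    hessian f x i j =
      fderiv ℝ (fderiv ℝ f) x (EuclideanSpace.single i 1) (EuclideanSpace.single j 1) := by
  have h : HasFDerivAt (fun y => fderiv ℝ f y (EuclideanSpace.single j 1))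
      ((fderiv ℝ (fderiv ℝ f) x).flip (EuclideanSpace.single j 1)) x := by
    simpa using (differentiable_fderiv hf x).hasFDerivAt.clm_apply
      (hasFDerivAt_const (EuclideanSpace.single j (1 : ℝ)) x)
  simp only [hessian, Matrix.of_apply]
  unfold pderiv
  rw [h.fderiv]
  simp

/-- The trace against `Mᵀ M` is the sum of second derivatives along the rows of `M`. -/
lemma trace_hessian_mul {f : EuclideanSpace ℝ (Fin d) → ℝ} (hf : ContDiff ℝ 2 f)
    (M : Matrix (Fin d) (Fin d) ℝ) (x : EuclideanSpace ℝ (Fin d)) :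
    Matrix.trace (hessian f x * (Mᵀ * M)) = ∑ k, secondDeriv f x (WithLp.toLp 2 (M k)) := by
  have hrow : ∀ k, (WithLp.toLp 2 (M k) : EuclideanSpace ℝ (Fin d))
      = ∑ i, M k i • EuclideanSpace.single i (1 : ℝ) := by
    intro k
    ext j
    simp [Finset.sum_apply, Pi.single_apply]
  simp only [Matrix.trace, Matrix.diag_apply, Matrix.mul_apply, Matrix.transpose_apply,
    hessian_apply hf, secondDeriv, hrow, map_sum, map_smul, sum_apply, smul_apply, smul_eq_mul]
  simp only [Finset.mul_sum]
  rw [Finset.sum_congr rfl fun i _ => Finset.sum_comm, Finset.sum_comm]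
  refine Finset.sum_congr rfl fun k _ => ?_
  rw [Finset.sum_comm]
  refine Finset.sum_congr rfl fun j _ => Finset.sum_congr rfl fun i _ => ?_
  ring

/-- The reduced corrector equation, multiplied by `2 R²`, is an ergodic equation. -/
lemma IsReducedCorrector.isErgodicSolution {m R κ T lam : ℝ} (hR : 0 < R)
    {M : Matrix (Fin d) (Fin d) ℝ} {ϖ : ℝ → ℝ → (Fin d → ℝ) → EuclideanSpace ℝ (Fin d) → ℝ}
    (h : IsReducedCorrector m R κ T (Mᵀ * M) lam ϖ) {t w : ℝ} (ht : t ∈ Icc 0 T)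
    (hw : w ∈ Ici (0 : ℝ)) (s : Fin d → ℝ) :
    IsErgodicSolution (fun k => WithLp.toLp 2 (M k))
      (powHamiltonian (EuclideanSpace.basisFun (Fin d) ℝ) m (2 * R ^ 2 / m * κ ^ (1 - m)))
      (fun x => R ^ 3 * ‖x‖ ^ 2) (2 * R ^ 2 * lam) (ϖ t w s) := by
  refine ⟨h.contDiff t ht w hw s, fun x => ?_⟩
  rw [← h.pde t ht w hw s x, trace_hessian_mul (h.contDiff t ht w hw s)]
  simp only [powHamiltonian, EuclideanSpace.basisFun_apply, ← Finset.mul_sum, pderiv]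
  field_simp
  ring

end Bridge

section Coefficients

variable {m R κ a : ℝ}

lemma gammaCoef_pos (hm : 2 < m) (hR : 0 < R) (hκ : 0 < κ) (ha : 0 < a) :
    0 < gammaCoef m R κ a := by
  have : 0 < m - 1 := by linarith
  have : 0 < m := by linarith
  unfold gammaCoef
  positivity

lemma betaCoef_pos (hm : 2 < m) (hR : 0 < R) (hκ : 0 < κ) (ha : 0 < a) :
    0 < betaCoef m R κ a := by
  have : 0 < m - 1 := by linarith
  have : 0 < m := by linarith
  unfold betaCoef
  positivity

lemma log_gammaCoef (hm : 2 < m) (hR : 0 < R) (hκ : 0 < κ) (ha : 0 < a) :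
    Real.log (gammaCoef m R κ a) = 1 / (3 * m - 2) * (Real.log 2 +
      (m - 1) * (Real.log m - (Real.log κ + Real.log (m - 1))) +
        ((3 * m - 1) * Real.log R - m * Real.log a)) := by
  have : 0 < m - 1 := by linarith
  have : 0 < m := by linarith
  unfold gammaCoef mStar
  rw [Real.log_rpow (by positivity), Real.log_mul (by positivity) (by positivity),
    Real.log_mul (by positivity) (by positivity), Real.log_rpow (by positivity),
    Real.log_div (by positivity) (by positivity), Real.log_div (by positivity) (by positivity),
    Real.log_mul (by positivity) (by positivity), Real.log_rpow hR, Real.log_rpow ha]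

lemma log_betaCoef (hm : 2 < m) (hR : 0 < R) (hκ : 0 < κ) (ha : 0 < a) :
    Real.log (betaCoef m R κ a) = -4 * (1 / (3 * m - 2)) * Real.log 2 +
      (4 * m * (1 / (3 * m - 2)) - 1) * Real.log a + (-1 - 4 * (1 / (3 * m - 2))) * Real.log R +
        4 * (m - 1) * (1 / (3 * m - 2)) * (Real.log κ + Real.log (m - 1) - Real.log m) := by
  have : 0 < m - 1 := by linarith
  have : 0 < m := by linarith
  unfold betaCoef mStar
  rw [Real.log_mul (by positivity) (by positivity), Real.log_mul (by positivity) (by positivity),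
    Real.log_mul (by positivity) (by positivity), Real.log_rpow (by positivity),
    Real.log_rpow ha, Real.log_rpow hR, Real.log_rpow (by positivity),
    Real.log_div (by positivity) (by positivity), Real.log_mul (by positivity) (by positivity)]

/-- Matching of the quadratic terms. -/
lemma betaCoef_mul_gammaCoef_pow_four (hm : 2 < m) (hR : 0 < R) (hκ : 0 < κ) (ha : 0 < a) :
    a * betaCoef m R κ a * gammaCoef m R κ a ^ 4 = R ^ 3 := by
  have hγ := gammaCoef_pos hm hR hκ ha
  have hβ := betaCoef_pos hm hR hκ ha
  refine Real.log_injOn_pos (mem_Ioi.2 (by positivity)) (mem_Ioi.2 (by positivity)) ?_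
  rw [Real.log_mul (by positivity) (by positivity), Real.log_mul (by positivity) (by positivity),
    Real.log_pow, Real.log_pow, log_gammaCoef hm hR hκ ha, log_betaCoef hm hR hκ ha]
  have : 3 * m - 2 ≠ 0 := by linarith
  push_cast
  field_simp
  ring

/-- Matching of the gradient terms. -/
lemma betaCoef_gammaCoef_gradient (hm : 2 < m) (hR : 0 < R) (hκ : 0 < κ) (ha : 0 < a) :
    1 / m * (κ ^ (1 - m) * (betaCoef m R κ a * gammaCoef m R κ a) ^ m) =
      1 / (2 * R ^ 2) * (a * betaCoef m R κ a * gammaCoef m R κ a ^ 2) *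
        (m ^ (-m) / (m - 1) ^ (1 - m)) := by
  have hγ := gammaCoef_pos hm hR hκ ha
  have hβ := betaCoef_pos hm hR hκ ha
  have h1 : 0 < m - 1 := by linarith
  have h0 : 0 < m := by linarith
  refine Real.log_injOn_pos (mem_Ioi.2 (by positivity)) (mem_Ioi.2 (by positivity)) ?_
  rw [one_div, one_div, Real.log_mul (by positivity) (by positivity),
    Real.log_mul (by positivity) (by positivity),
    Real.log_rpow hκ, Real.log_rpow (by positivity), Real.log_mul hβ.ne' hγ.ne',
    Real.log_mul (by positivity) (by positivity), Real.log_mul (by positivity) (by positivity),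
    Real.log_mul (by positivity) (by positivity), Real.log_mul ha.ne' hβ.ne',
    Real.log_div (by positivity) (by positivity), Real.log_rpow h0, Real.log_rpow h1,
    Real.log_inv, Real.log_inv, Real.log_mul (by positivity) (by positivity),
    Real.log_pow, Real.log_pow, log_gammaCoef hm hR hκ ha, log_betaCoef hm hR hκ ha]
  have : 3 * m - 2 ≠ 0 := by linarith
  have hn := one_div_mul_cancel this
  push_cast
  linear_combination (-Real.log 2 + m * Real.log a + (m - 3) * Real.log R +
    (m - 1) * (Real.log κ + Real.log (m - 1) - Real.log m)) * hn

end Coefficients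

section Separable

variable {d : ℕ}

/-- The separable function `x ↦ ∑ⱼ βⱼ φ(γⱼ xⱼ)` with arbitrary coefficients. -/
def sepSum (β γ : Fin d → ℝ) (φ : ℝ → ℝ) (x : EuclideanSpace ℝ (Fin d)) : ℝ :=
  ∑ j, β j * φ (γ j * x j)

variable {β γ : Fin d → ℝ} {φ : ℝ → ℝ}

lemma contDiff_sepSum (hφ : ContDiff ℝ 2 φ) : ContDiff ℝ 2 (sepSum β γ φ) := by
  unfold sepSum
  fun_prop

lemma hasFDerivAt_coord (j : Fin d) (x : EuclideanSpace ℝ (Fin d)) :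
    HasFDerivAt (fun x : EuclideanSpace ℝ (Fin d) => x j)
      (EuclideanSpace.proj j : EuclideanSpace ℝ (Fin d) →L[ℝ] ℝ) x :=
  (EuclideanSpace.proj j : EuclideanSpace ℝ (Fin d) →L[ℝ] ℝ).hasFDerivAt

lemma pderiv_sepSum {p : ℝ → ℝ} (hφ : ∀ x, HasDerivAt φ (p x) x) (i : Fin d) :
    pderiv i (sepSum β γ φ) = fun x => β i * γ i * p (γ i * x i) := by
  ext x
  have h : HasFDerivAt (sepSum β γ φ) (∑ j, β j • (p (γ j * x j) •
      (γ j • (EuclideanSpace.proj j : EuclideanSpace ℝ (Fin d) →L[ℝ] ℝ)))) x :=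
    HasFDerivAt.fun_sum fun j _ => (((hφ (γ j * x j)).comp_hasFDerivAt x
      ((hasFDerivAt_coord j x).const_mul (γ j)))).const_mul (β j)
  rw [pderiv, h.fderiv]
  simp
  ring

lemma hessian_sepSum {p p' : ℝ → ℝ} (hφ : ∀ x, HasDerivAt φ (p x) x)
    (hp : ∀ x, HasDerivAt p (p' x) x) (x : EuclideanSpace ℝ (Fin d)) :
    hessian (sepSum β γ φ) x
      = Matrix.diagonal fun j => β j * γ j ^ 2 * p' (γ j * x j) := by
  ext i j
  have h : HasFDerivAt (fun x : EuclideanSpace ℝ (Fin d) => β j * γ j * p (γ j * x j))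
      ((β j * γ j) • (p' (γ j * x j) •
        (γ j • (EuclideanSpace.proj j : EuclideanSpace ℝ (Fin d) →L[ℝ] ℝ)))) x :=
    (((hp (γ j * x j)).comp_hasFDerivAt x
      ((hasFDerivAt_coord j x).const_mul (γ j)))).const_mul (β j * γ j)
  simp only [hessian, Matrix.of_apply, pderiv_sepSum hφ]
  rw [pderiv, h.fderiv, Matrix.diagonal_apply]
  by_cases hij : i = j
  · subst hij; simp; ring
  · simp [hij, Ne.symm hij]

lemma convexOn_sepSum (hφ : ConvexOn ℝ univ φ) (hβ : ∀ j, 0 ≤ β j) :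
    ConvexOn ℝ univ (sepSum β γ φ) := by
  refine ⟨convex_univ, fun x _ y _ u v hu hv huv => ?_⟩
  simp only [sepSum, smul_eq_mul, Finset.mul_sum, ← Finset.sum_add_distrib]
  refine Finset.sum_le_sum fun j _ => ?_
  have h1 := hφ.2 (mem_univ (γ j * x j)) (mem_univ (γ j * y j)) hu hv huv
  simp only [smul_eq_mul] at h1
  have h2 : γ j * (u • x + v • y) j = u * (γ j * x j) + v * (γ j * y j) := by
    simp; ring
  rw [h2]
  have := mul_le_mul_of_nonneg_left h1 (hβ j)
  linarith

lemma norm_rpow_le_sum (x : EuclideanSpace ℝ (Fin d)) {α : ℝ} (hα : 0 < α) :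
    ‖x‖ ^ α ≤ (d : ℝ) ^ α * ∑ j, |x j| ^ α := by
  rcases isEmpty_or_nonempty (Fin d) with h | h
  · have : x = 0 := by ext j; exact h.elim j
    subst this
    simp [Real.zero_rpow hα.ne']
  · obtain ⟨i, hi⟩ := Finite.exists_max fun j => |x j|
    have h1 : ‖x‖ ≤ ∑ j, |x j| := by
      have hx : x = ∑ j, x j • EuclideanSpace.single j (1 : ℝ) := by
        ext k; simp [Pi.single_apply]
      conv_lhs => rw [hx]
      refine (norm_sum_le _ _).trans_eq ?_
      simp [norm_smul]
    have h2 : ∑ j, |x j| ≤ d * |x i| := by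
      refine (Finset.sum_le_sum fun j _ => hi j).trans_eq ?_
      simp
    have h3 : ‖x‖ ^ α ≤ (d * |x i|) ^ α := by
      have := h1.trans h2
      gcongr
    rw [Real.mul_rpow (by positivity) (abs_nonneg _)] at h3
    refine h3.trans (mul_le_mul_of_nonneg_left ?_ (by positivity))
    exact Finset.single_le_sum (f := fun j => |x j| ^ α) (fun j _ => by positivity)
      (Finset.mem_univ i)

lemma exists_le_sepSum (hβ : ∀ j, 0 < β j) (hγ : ∀ j, 0 < γ j) {α C₀ C : ℝ} (hα : 0 < α)
    (hC₀ : 0 < C₀) (hC : 0 < C) (hφ : ∀ x, C₀ * |x| ^ α - C ≤ φ x) :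
    ∃ D₀ D, 0 < D₀ ∧ 0 < D ∧ ∀ x, D₀ * ‖x‖ ^ α - D ≤ sepSum β γ φ x := by
  obtain ⟨c, hc, hcle⟩ : ∃ c, 0 < c ∧ ∀ j, c ≤ β j * (C₀ * γ j ^ α) := by
    have hpos : ∀ j, 0 < β j * (C₀ * γ j ^ α) := fun j => by
      have := hβ j
      have := hγ j
      positivity
    rcases isEmpty_or_nonempty (Fin d) with h | h
    · exact ⟨1, one_pos, fun j => h.elim j⟩
    · obtain ⟨i, hi⟩ := Finite.exists_min fun j => β j * (C₀ * γ j ^ α)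
      exact ⟨_, hpos i, hi⟩
  have hβs : 0 ≤ ∑ j, β j := Finset.sum_nonneg fun j _ => (hβ j).le
  refine ⟨c / ((d : ℝ) ^ α + 1), (∑ j, β j) * C + 1, by positivity, by positivity, fun x => ?_⟩
  have h1 : ∑ j, (c * |x j| ^ α - β j * C) ≤ sepSum β γ φ x := by
    refine Finset.sum_le_sum fun j _ => ?_
    have h2 := mul_le_mul_of_nonneg_left (hφ (γ j * x j)) (hβ j).le
    rw [abs_mul, abs_of_pos (hγ j), Real.mul_rpow (hγ j).le (abs_nonneg _)] at h2
    have h3 := mul_le_mul_of_nonneg_right (hcle j) (Real.rpow_nonneg (abs_nonneg (x j)) α)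
    linarith
  rw [Finset.sum_sub_distrib, ← Finset.mul_sum, ← Finset.sum_mul] at h1
  have hS : 0 ≤ ∑ j, |x j| ^ α := Finset.sum_nonneg fun j _ => by positivity
  have h4 : c / ((d : ℝ) ^ α + 1) * ‖x‖ ^ α ≤ c * ∑ j, |x j| ^ α := by
    rw [div_mul_eq_mul_div, div_le_iff₀ (by positivity), mul_assoc]
    refine mul_le_mul_of_nonneg_left ?_ hc.le
    have := norm_rpow_le_sum x hα
    nlinarith
  linarith

lemma abs_coord_le_norm (x : EuclideanSpace ℝ (Fin d)) (j : Fin d) : |x j| ≤ ‖x‖ := by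
  simpa using PiLp.norm_apply_le x j

lemma exists_sepSum_le (hβ : ∀ j, 0 < β j) (hγ : ∀ j, 0 < γ j) {α C : ℝ} (hα : 0 < α)
    (hC : 0 < C) (hφ : ∀ x, φ x ≤ C * (1 + |x| ^ α)) :
    ∃ D, 0 < D ∧ ∀ x, sepSum β γ φ x ≤ D * (1 + ‖x‖ ^ α) := by
  have hS : 0 ≤ ∑ j, β j * (C * (1 + γ j ^ α)) := Finset.sum_nonneg fun j _ => by
    have := hβ j
    have := hγ j
    positivity
  refine ⟨∑ j, β j * (C * (1 + γ j ^ α)) + 1, by positivity, fun x => ?_⟩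
  have hx : 0 ≤ ‖x‖ ^ α := by positivity
  have h1 : sepSum β γ φ x ≤ (∑ j, β j * (C * (1 + γ j ^ α))) * (1 + ‖x‖ ^ α) := by
    rw [Finset.sum_mul]
    refine Finset.sum_le_sum fun j _ => ?_
    have hγj : 0 ≤ γ j ^ α := Real.rpow_nonneg (hγ j).le α
    have h2 := hφ (γ j * x j)
    rw [abs_mul, abs_of_pos (hγ j), Real.mul_rpow (hγ j).le (abs_nonneg _)] at h2
    have h3 : |x j| ^ α ≤ ‖x‖ ^ α :=
      Real.rpow_le_rpow (abs_nonneg _) (abs_coord_le_norm x j) hα.le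
    have h4 : 1 + γ j ^ α * |x j| ^ α ≤ (1 + γ j ^ α) * (1 + ‖x‖ ^ α) := by
      have := mul_le_mul_of_nonneg_left h3 hγj
      linarith
    have h5 := mul_le_mul_of_nonneg_left h4 hC.le
    have h6 := mul_le_mul_of_nonneg_left (h2.trans h5) (hβ j).le
    linarith
  linarith

end Separable

/-! ### The separable corrector -/

/-- Growth of order `‖x‖^α` written with the smooth weight `(1 + ‖x‖²)^(α/2)`. -/
lemma exists_smooth_weight_bounds {E : Type*} [NormedAddCommGroup E] {f : E → ℝ} {α D₀ D D' : ℝ}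
    (hα : 0 < α) (hD₀ : 0 < D₀) (hD : 0 < D) (hD' : 0 < D')
    (hlow : ∀ x, D₀ * ‖x‖ ^ α - D ≤ f x) (hup : ∀ x, f x ≤ D' * (1 + ‖x‖ ^ α)) :
    ∃ C : ℝ, 0 < C ∧ ∀ x, (1 + ‖x‖ ^ 2) ^ (α / 2) / C - C ≤ f x ∧
      f x ≤ C * (1 + ‖x‖ ^ 2) ^ (α / 2) := by
  have hpow : ∀ x : E, (‖x‖ ^ 2) ^ (α / 2) = ‖x‖ ^ α := fun x => by
    rw [← Real.rpow_two, ← Real.rpow_mul (norm_nonneg x), mul_div_cancel₀ α two_ne_zero]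
  refine ⟨2 * D' + 2 ^ (α / 2) / D₀ + D₀ + D, by positivity, fun x => ⟨?_, ?_⟩⟩
  · have h1 := add_rpow_le_two_rpow_mul zero_le_one (sq_nonneg ‖x‖) (by positivity : 0 ≤ α / 2)
    rw [hpow, Real.one_rpow] at h1
    have h2 : (1 + ‖x‖ ^ 2) ^ (α / 2) / (2 * D' + 2 ^ (α / 2) / D₀ + D₀ + D)
        ≤ D₀ * (1 + ‖x‖ ^ α) := by
      rw [div_le_iff₀ (by positivity)]
      have h3 : D₀ * (1 + ‖x‖ ^ α) * (2 ^ (α / 2) / D₀) = 2 ^ (α / 2) * (1 + ‖x‖ ^ α) := by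
        field_simp
      have h4 : 0 ≤ D₀ * (1 + ‖x‖ ^ α) * (2 * D' + D₀ + D) := by positivity
      linarith
    have h5 : 0 < (2 : ℝ) ^ (α / 2) / D₀ := by positivity
    linarith [hlow x]
  · have h1 : 1 ≤ (1 + ‖x‖ ^ 2) ^ (α / 2) :=
      Real.one_le_rpow (by linarith [sq_nonneg ‖x‖]) (by positivity)
    have h2 : ‖x‖ ^ α ≤ (1 + ‖x‖ ^ 2) ^ (α / 2) := by
      rw [← hpow]
      gcongr
      linarith
    have h3 : D' * (1 + ‖x‖ ^ α) ≤ D' * (2 * (1 + ‖x‖ ^ 2) ^ (α / 2)) := by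
      gcongr
      linarith
    have h4 : 0 ≤ (2 ^ (α / 2) / D₀ + D₀ + D) * (1 + ‖x‖ ^ 2) ^ (α / 2) := by positivity
    linarith [hup x]

section Corrector

variable {m R κ T lam b : ℝ} {p : ℝ → ℝ} {d : ℕ}

/-- The separable function solves the reduced equation: with the given coefficients every
coordinate satisfies a rescaled one-dimensional equation, and only the diagonal of `A` acts on a
diagonal Hessian. -/
lemma IsOddProfile.sepCorrector_pde (hm : 2 < m) (hR : 0 < R) (hκ : 0 < κ)
    {A : Matrix (Fin d) (Fin d) ℝ} (hA : ∀ j, 0 < A j j)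
    (h : IsOddProfile m (m ^ (-m) / (m - 1) ^ (1 - m)) (m * (m - 1) ^ (1 / m - 1)) lam b p)
    (x : EuclideanSpace ℝ (Fin d)) :
    R / 2 * ‖x‖ ^ 2
      - 1 / m * ∑ j, κ ^ (1 - m) * |pderiv j (sepCorrector m R κ A (primitive p)) x| ^ m
      + 1 / (2 * R ^ 2) * Matrix.trace (hessian (sepCorrector m R κ A (primitive p)) x * A)
      = sepConst m R κ A lam := by
  have hs : sepCorrector m R κ A (primitive p) = sepSum (fun j => betaCoef m R κ (A j j))
    (fun j => gammaCoef m R κ (A j j)) (primitive p) := rfl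
  rw [hs, hessian_sepSum h.hasDerivAt_primitive h.hasDerivAt, EuclideanSpace.norm_sq_eq]
  simp only [pderiv_sepSum h.hasDerivAt_primitive, Matrix.trace, Matrix.diag_apply,
    Matrix.diagonal_mul, sepConst, Finset.mul_sum, ← Finset.sum_sub_distrib,
    ← Finset.sum_add_distrib]
  refine Finset.sum_congr rfl fun j _ => ?_
  have hγ := gammaCoef_pos hm hR hκ (hA j)
  have hβ := betaCoef_pos hm hR hκ (hA j)
  have h1 := betaCoef_mul_gammaCoef_pow_four hm hR hκ (hA j)
  have h2 := betaCoef_gammaCoef_gradient hm hR hκ (hA j)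
  set β := betaCoef m R κ (A j j)
  set γ := gammaCoef m R κ (A j j)
  set c := m ^ (-m) / (m - 1) ^ (1 - m)
  have h3 : A j j * β * γ ^ 2 = R ^ 3 / γ ^ 2 := by
    rw [eq_div_iff (by positivity), ← h1]; ring
  rw [abs_mul, abs_of_pos (mul_pos hβ hγ), Real.mul_rpow (by positivity) (abs_nonneg _),
    Real.norm_eq_abs, sq_abs]
  have h4 : 1 / m * (κ ^ (1 - m) * ((β * γ) ^ m * |p (γ * x j)| ^ m))
      = 1 / (2 * R ^ 2) * (R ^ 3 / γ ^ 2) * c * |p (γ * x j)| ^ m := by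
    rw [← h3, ← h2]; ring
  have h5 : 1 / (2 * R ^ 2) * (β * γ ^ 2 * (-(γ * x j) ^ 2 + lam + c * |p (γ * x j)| ^ m) * A j j)
      = 1 / (2 * R ^ 2) * (R ^ 3 / γ ^ 2) * (-(γ * x j) ^ 2 + lam + c * |p (γ * x j)| ^ m) := by
    rw [← h3]; ring
  rw [h4, h5]
  field_simp
  ring

lemma IsOddProfile.exists_growth_sepCorrector (hm : 2 < m) (hR : 0 < R) (hκ : 0 < κ)
    {A : Matrix (Fin d) (Fin d) ℝ} (hA : ∀ j, 0 < A j j)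
    (h : IsOddProfile m (m ^ (-m) / (m - 1) ^ (1 - m)) (m * (m - 1) ^ (1 / m - 1)) lam b p) :
    ∃ C : ℝ, 0 < C ∧ ∀ x : EuclideanSpace ℝ (Fin d),
      (1 + ‖x‖ ^ 2) ^ (1 / 2 + 1 / m) / C - C ≤ sepCorrector m R κ A (primitive p) x ∧
        sepCorrector m R κ A (primitive p) x ≤ C * (1 + ‖x‖ ^ 2) ^ (1 / 2 + 1 / m) := by
  obtain ⟨hc, hℓ, hcℓ⟩ := corrector_coefficients hm
  have hm0 : 0 < m := by linarith
  have hα : 0 < 1 + 2 / m := by positivity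
  obtain ⟨C₀, C, hC₀, hC, hlow⟩ := h.exists_le_primitive hm hℓ hcℓ
  obtain ⟨C', hC', hup⟩ := h.exists_primitive_le hm hℓ
  obtain ⟨D₀, D, hD₀, hD, hlow'⟩ := exists_le_sepSum
    (fun j => betaCoef_pos hm hR hκ (hA j)) (fun j => gammaCoef_pos hm hR hκ (hA j)) hα hC₀ hC hlow
  obtain ⟨D', hD', hup'⟩ := exists_sepSum_le
    (fun j => betaCoef_pos hm hR hκ (hA j)) (fun j => gammaCoef_pos hm hR hκ (hA j)) hα hC' hup
  have := exists_smooth_weight_bounds hα hD₀ hD hD' hlow' hup'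
  rwa [show (1 + 2 / m) / 2 = 1 / 2 + 1 / m by ring] at this

lemma IsOddProfile.sepCorrector_nonneg (hm : 2 < m) (hR : 0 < R) (hκ : 0 < κ)
    {A : Matrix (Fin d) (Fin d) ℝ} (hA : ∀ j, 0 < A j j) {c ℓ : ℝ}
    (h : IsOddProfile m c ℓ lam b p) (x : EuclideanSpace ℝ (Fin d)) :
    0 ≤ sepCorrector m R κ A (primitive p) x :=
  Finset.sum_nonneg fun j _ => mul_nonneg (betaCoef_pos hm hR hκ (hA j)).le (h.primitive_nonneg _)

lemma IsOddProfile.isReducedCorrector (hm : 2 < m) (hR : 0 < R) (hκ : 0 < κ)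
    {A : Matrix (Fin d) (Fin d) ℝ} (hA : ∀ j, 0 < A j j)
    (h : IsOddProfile m (m ^ (-m) / (m - 1) ^ (1 - m)) (m * (m - 1) ^ (1 / m - 1)) lam b p) :
    IsReducedCorrector m R κ T A (sepConst m R κ A lam)
      (fun _ _ _ => sepCorrector m R κ A (primitive p)) := by
  have hm0 : 0 < m := by linarith
  refine ⟨fun _ _ _ _ _ => contDiff_sepSum (h.contDiff_primitive hm),
    fun _ _ _ _ _ x => h.sepCorrector_pde hm hR hκ hA x,
    fun _ _ _ _ _ => by simp [sepCorrector, primitive_zero],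
    fun _ _ _ _ _ x => h.sepCorrector_nonneg hm hR hκ hA x, fun _ _ _ _ _ => ?_⟩
  obtain ⟨C, hC, hb⟩ := h.exists_growth_sepCorrector hm hR hκ hA
  have hnorm : Tendsto (fun x : EuclideanSpace ℝ (Fin d) => (1 + ‖x‖ ^ 2) ^ (1 / 2 + 1 / m))
      (cocompact _) atTop := by
    refine (tendsto_rpow_atTop (show 0 < 1 / 2 + 1 / m by positivity)).comp ?_
    exact tendsto_atTop_add_const_left _ 1
      ((tendsto_pow_atTop two_ne_zero).comp tendsto_norm_cocompact_atTop)
  have hev : ∀ᶠ x in cocompact (EuclideanSpace ℝ (Fin d)),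
      (1 : EReal) ≤ ((sepCorrector m R κ A (primitive p) x : ℝ) : EReal) := by
    filter_upwards [hnorm.eventually_ge_atTop (C * (C + 1))] with x hx
    have h1 : C + 1 ≤ (1 + ‖x‖ ^ 2) ^ (1 / 2 + 1 / m) / C := by
      rw [le_div_iff₀ hC]; linarith
    have h2 := (hb x).1
    have h3 : 1 ≤ sepCorrector m R κ A (primitive p) x := by linarith
    exact_mod_cast h3
  exact lt_of_lt_of_le zero_lt_one (le_liminf_of_le (by isBoundedDefault) hev)

/-- Uniqueness for the reduced equation: for fixed `(t, w, s)` both candidates solve the same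
ergodic equation on `ℝᵈ`, and their difference is a constant, which the normalization at the origin
fixes. The drift `-∇H(∇ϖ)` points towards the origin because `φ'` has the sign of its argument. -/
lemma IsOddProfile.reducedCorrector_unique (hm : 2 < m) (hR : 0 < R) (hκ : 0 < κ) (hT : 0 < T)
    {M : Matrix (Fin d) (Fin d) ℝ} (hA : ∀ j, 0 < (Mᵀ * M) j j)
    (h : IsOddProfile m (m ^ (-m) / (m - 1) ^ (1 - m)) (m * (m - 1) ^ (1 / m - 1)) lam b p)
    {lam' : ℝ} {ϖ' : ℝ → ℝ → (Fin d → ℝ) → EuclideanSpace ℝ (Fin d) → ℝ}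
    (h' : IsReducedCorrector m R κ T (Mᵀ * M) lam' ϖ') :
    lam' = sepConst m R κ (Mᵀ * M) lam ∧ ∀ t ∈ Icc 0 T, ∀ w ∈ Ici (0 : ℝ), ∀ s, ∀ x,
      ϖ' t w s x = sepCorrector m R κ (Mᵀ * M) (primitive p) x := by
  obtain ⟨hc, hℓ, hcℓ⟩ := corrector_coefficients hm
  have hm0 : 0 < m := by linarith
  have hred := h.isReducedCorrector (T := T) hm hR hκ hA
  have hq : Tendsto (fun x : EuclideanSpace ℝ (Fin d) => R ^ 3 * ‖x‖ ^ 2) (cocompact _) atTop :=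
    ((tendsto_pow_atTop two_ne_zero).comp tendsto_norm_cocompact_atTop).const_mul_atTop
      (by positivity)
  have hcH : 0 < 2 * R ^ 2 / m * κ ^ (1 - m) := by positivity
  have key : ∀ t ∈ Icc 0 T, ∀ w ∈ Ici (0 : ℝ), ∀ s,
      2 * R ^ 2 * lam' = 2 * R ^ 2 * sepConst m R κ (Mᵀ * M) lam ∧
      ∀ x, ϖ' t w s x - sepCorrector m R κ (Mᵀ * M) (primitive p) x
        = ϖ' t w s 0 - sepCorrector m R κ (Mᵀ * M) (primitive p) 0 := by
    intro t ht w hw s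
    refine (hred.isErgodicSolution hR ht hw s).unique (by linarith)
      (isSuperquadratic_powHamiltonian (EuclideanSpace.basisFun (Fin d) ℝ) hm hcH)
      (fun x => by positivity) hq (h.sepCorrector_nonneg hm hR hκ hA)
      (h'.isErgodicSolution hR ht hw s) (h'.nonneg t ht w hw s) fun x hx => ?_
    refine inner_powDrift_pos _ hm0 hcH hx fun j hj => ?_
    have hγ := gammaCoef_pos hm hR hκ (hA j)
    have hβ := betaCoef_pos hm hR hκ (hA j)
    have h3 : inner ℝ (EuclideanSpace.single j (1 : ℝ)) x = x j := by
      rw [EuclideanSpace.inner_single_left, map_one, one_mul]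
    rw [EuclideanSpace.basisFun_apply, h3] at hj
    have h1 := h.mul_self_pos hc (mul_ne_zero hγ.ne' hj)
    have h2 : fderiv ℝ (sepCorrector m R κ (Mᵀ * M) (primitive p)) x
        (EuclideanSpace.single j 1) = betaCoef m R κ ((Mᵀ * M) j j) *
          gammaCoef m R κ ((Mᵀ * M) j j) * p (gammaCoef m R κ ((Mᵀ * M) j j) * x j) :=
      congrFun (pderiv_sepSum (β := fun j => betaCoef m R κ ((Mᵀ * M) j j))
        (γ := fun j => gammaCoef m R κ ((Mᵀ * M) j j)) h.hasDerivAt_primitive j) x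
    rw [EuclideanSpace.basisFun_apply, h2, h3]
    have := mul_pos hβ h1
    linarith
  have hR2 : 2 * R ^ 2 ≠ 0 := by positivity
  refine ⟨mul_left_cancel₀ hR2 (key 0 ⟨le_rfl, hT.le⟩ 0 self_mem_Ici 0).1,
    fun t ht w hw s x => ?_⟩
  have h1 := (key t ht w hw s).2 x
  rw [h'.zero t ht w hw s, hred.zero t ht w hw s] at h1
  linarith

lemma IsOddProfile.exists_derivative_bound (hm : 2 < m) (hR : 0 < R) (hκ : 0 < κ)
    {A : Matrix (Fin d) (Fin d) ℝ} (hA : ∀ j, 0 < A j j)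
    (h : IsOddProfile m (m ^ (-m) / (m - 1) ^ (1 - m)) (m * (m - 1) ^ (1 / m - 1)) lam b p) :
    ∃ K : ℝ, ∀ (i : Fin d) (x : EuclideanSpace ℝ (Fin d)), x ≠ 0 →
      sepCorrector m R κ A (primitive p) x ≠ 0 ∧
      |pderiv i (sepCorrector m R κ A (primitive p)) x * x i /
          sepCorrector m R κ A (primitive p) x|
        + |pderiv i (sepCorrector m R κ A (primitive p)) x / ‖x‖|
        + |pderiv i (sepCorrector m R κ A (primitive p)) x / (1 + ‖x‖ ^ (2 / m))| ≤ K := by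
  obtain ⟨hc, hℓ, hcℓ⟩ := corrector_coefficients hm
  have hm0 : 0 < m := by linarith
  obtain ⟨K₁, hK₁, hp₁⟩ := h.exists_mul_self_le_primitive hm hc hℓ hcℓ
  obtain ⟨K₂, hK₂, hp₂⟩ := h.exists_abs_le_abs hm hc hℓ
  obtain ⟨K₃, hK₃, hp₃⟩ := h.exists_abs_le_rpow hm hℓ
  set ϖ := sepCorrector m R κ A (primitive p) with hϖ
  set β : Fin d → ℝ := fun j => betaCoef m R κ (A j j) with hβdef
  set γ : Fin d → ℝ := fun j => gammaCoef m R κ (A j j) with hγdef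
  have hβ : ∀ j, 0 < β j := fun j => betaCoef_pos hm hR hκ (hA j)
  have hγ : ∀ j, 0 < γ j := fun j => gammaCoef_pos hm hR hκ (hA j)
  have hpd : ∀ i x, pderiv i ϖ x = β i * γ i * p (γ i * x i) := fun i x =>
    congrFun (pderiv_sepSum (β := β) (γ := γ) h.hasDerivAt_primitive i) x
  have hterm : ∀ i x, β i * primitive p (γ i * x i) ≤ ϖ x := fun i x =>
    Finset.single_le_sum (f := fun j => β j * primitive p (γ j * x j))
      (fun j _ => mul_nonneg (hβ j).le (h.primitive_nonneg _)) (Finset.mem_univ i)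
  set L : Fin d → ℝ := fun i => β i * γ i * (K₂ * γ i) + β i * γ i * (K₃ * (1 + γ i ^ (2 / m)))
    with hL
  have hL0 : ∀ i, 0 ≤ L i := fun i => by
    have := hβ i
    have := hγ i
    simp only [hL]
    positivity
  refine ⟨K₁ + ∑ i, L i, fun i x hx => ?_⟩
  have hϖpos : 0 < ϖ x := by
    obtain ⟨j, hj⟩ : ∃ j, x j ≠ 0 := by
      by_contra hcon
      push Not at hcon
      exact hx (by ext j; simpa using hcon j)
    exact (mul_pos (hβ j) (h.primitive_pos hc (mul_ne_zero (hγ j).ne' hj))).trans_le (hterm j x)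
  refine ⟨hϖpos.ne', ?_⟩
  have hβi := hβ i
  have hγi := hγ i
  have hxn : 0 < ‖x‖ := norm_pos_iff.2 hx
  have hxi := abs_coord_le_norm x i
  have hγx : |γ i * x i| = γ i * |x i| := by rw [abs_mul, abs_of_pos hγi]
  have hpi : |pderiv i ϖ x| = β i * γ i * |p (γ i * x i)| := by
    rw [hpd, abs_mul, abs_of_pos (mul_pos hβi hγi)]
  have e1 : |pderiv i ϖ x * x i / ϖ x| ≤ K₁ := by
    have h1 : pderiv i ϖ x * x i = β i * (p (γ i * x i) * (γ i * x i)) := by rw [hpd]; ring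
    rw [h1, abs_div, abs_of_pos hϖpos,
      abs_of_nonneg (mul_nonneg hβi.le (h.mul_self_nonneg _)), div_le_iff₀ hϖpos]
    have h2 := mul_le_mul_of_nonneg_left (hp₁ (γ i * x i)) hβi.le
    have h3 := mul_le_mul_of_nonneg_left (hterm i x) hK₁.le
    linarith
  have e2 : |pderiv i ϖ x / ‖x‖| ≤ β i * γ i * (K₂ * γ i) := by
    rw [abs_div, abs_of_pos hxn, div_le_iff₀ hxn, hpi, mul_assoc _ (K₂ * γ i)]
    refine mul_le_mul_of_nonneg_left ?_ (by positivity)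
    refine (hp₂ _).trans ?_
    rw [hγx, ← mul_assoc]
    gcongr
  have e3 : |pderiv i ϖ x / (1 + ‖x‖ ^ (2 / m))| ≤ β i * γ i * (K₃ * (1 + γ i ^ (2 / m))) := by
    have hden : 0 < 1 + ‖x‖ ^ (2 / m) := by positivity
    rw [abs_div, abs_of_pos hden, div_le_iff₀ hden, hpi, mul_assoc _ (K₃ * (1 + γ i ^ (2 / m)))]
    refine mul_le_mul_of_nonneg_left ((hp₃ _).trans ?_) (by positivity)
    rw [hγx, Real.mul_rpow hγi.le (abs_nonneg _), mul_assoc]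
    refine mul_le_mul_of_nonneg_left ?_ hK₃.le
    have h1 : |x i| ^ (2 / m) ≤ ‖x‖ ^ (2 / m) := by gcongr
    have h2 : 0 ≤ γ i ^ (2 / m) := by positivity
    have h3 := mul_le_mul_of_nonneg_left h1 h2
    have h4 : 0 ≤ ‖x‖ ^ (2 / m) := by positivity
    linarith
  have e4 : L i ≤ ∑ j, L j := Finset.single_le_sum (fun j _ => hL0 j) (Finset.mem_univ i)
  simp only [hL] at e4
  linarith

end Corrector

end PriceImpact

end

theorem lemma4p2 (m : ℝ) (hm : 2 < m) (d : ℕ)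
    (σ : Matrix (Fin d) (Fin d) ℝ) (hσ : (σ * σᵀ).PosDef)
    (μ : Fin d → ℝ) (r R κ T : ℝ) (hR : 0 < R) (hκ : 0 < κ) (hT : 0 < T)
    (hdiag : ∀ j, 0 < PriceImpact.diffMat σ μ r R j j) :
    -- the one-dimensional problem determines the pair `(lam1, ϖ1)`, which depends only on `m`
    (∃! p : ℝ × (ℝ → ℝ), PriceImpact.IsOneDimCorrector m p.1 p.2) ∧
    ∀ (lam1 : ℝ) (ϖ1 : ℝ → ℝ), PriceImpact.IsOneDimCorrector m lam1 ϖ1 →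
    ∀ (A : Matrix (Fin d) (Fin d) ℝ), A = PriceImpact.diffMat σ μ r R →
    ∀ (lam : ℝ), lam = PriceImpact.sepConst m R κ A lam1 →
    ∀ (ϖ : EuclideanSpace ℝ (Fin d) → ℝ), ϖ = PriceImpact.sepCorrector m R κ A ϖ1 →
      0 < lam1 ∧
      -- existence
      PriceImpact.IsReducedCorrector m R κ T A lam (fun _ _ _ => ϖ) ∧
      -- uniqueness
      (∀ (lam' : ℝ) (ϖ' : ℝ → ℝ → (Fin d → ℝ) → EuclideanSpace ℝ (Fin d) → ℝ),
        PriceImpact.IsReducedCorrector m R κ T A lam' ϖ' →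
        lam' = lam ∧
          ∀ t ∈ Icc 0 T, ∀ w ∈ Ici (0 : ℝ), ∀ s, ∀ x, ϖ' t w s x = ϖ x) ∧
      -- regularity and convexity
      ContDiff ℝ 2 ϖ1 ∧ ConvexOn ℝ univ ϖ1 ∧
      ContDiff ℝ 2 ϖ ∧ ConvexOn ℝ univ ϖ ∧
      -- growth
      Tendsto (fun x : ℝ => ϖ1 x / |x| ^ (1 + 2 / m)) (cocompact ℝ)
        (𝓝 (m ^ 2 / ((m + 2) * (m - 1) ^ (1 - 1 / m)))) ∧
      (∃ C : ℝ, 0 < C ∧ ∀ x : EuclideanSpace ℝ (Fin d),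
        (1 + ‖x‖ ^ 2) ^ (1 / 2 + 1 / m) / C - C ≤ ϖ x ∧
          ϖ x ≤ C * (1 + ‖x‖ ^ 2) ^ (1 / 2 + 1 / m)) ∧
      -- derivative bounds
      (∃ K : ℝ, ∀ (i : Fin d) (x : EuclideanSpace ℝ (Fin d)), x ≠ 0 →
        ϖ x ≠ 0 ∧
        |PriceImpact.pderiv i ϖ x * x i / ϖ x| + |PriceImpact.pderiv i ϖ x / ‖x‖|
          + |PriceImpact.pderiv i ϖ x / (1 + ‖x‖ ^ (2 / m))| ≤ K) := by
  obtain ⟨hc, hℓ, hcℓ⟩ := PriceImpact.corrector_coefficients hm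
  obtain ⟨lam₀, b, p, h⟩ := PriceImpact.exists_isOddProfile hm hc hℓ hcℓ
  have hm1 : 0 < m - 1 := by linarith
  refine ⟨⟨(lam₀, PriceImpact.primitive p), h.isOneDimCorrector hm, ?_⟩, ?_⟩
  · rintro ⟨l, φ⟩ hφ
    obtain ⟨h1, h2⟩ := hφ.eq_primitive hm h
    exact Prod.ext h1 h2
  intro lam1 ϖ1 hϖ1 A hA lam hlam ϖ hϖ
  obtain ⟨rfl, rfl⟩ := hϖ1.eq_primitive hm h
  subst hA hlam hϖ
  -- `diffMat` is by definition of the form `Mᵀ * M`, as `reducedCorrector_unique` requires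
  refine ⟨h.lam_pos, h.isReducedCorrector hm hR hκ hdiag,
    fun lam' ϖ' h' => h.reducedCorrector_unique hm hR hκ hT hdiag h', h.contDiff_primitive hm,
    h.convexOn_primitive, PriceImpact.contDiff_sepSum (h.contDiff_primitive hm),
    PriceImpact.convexOn_sepSum h.convexOn_primitive
      fun j => (PriceImpact.betaCoef_pos hm hR hκ (hdiag j)).le, ?_,
    h.exists_growth_sepCorrector hm hR hκ hdiag, h.exists_derivative_bound hm hR hκ hdiag⟩
  have hlim : m * (m - 1) ^ (1 / m - 1) / (1 + 2 / m)
      = m ^ 2 / ((m + 2) * (m - 1) ^ (1 - 1 / m)) := by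
    rw [show 1 / m - 1 = -(1 - 1 / m) by ring, Real.rpow_neg hm1.le]
    have : (m - 1) ^ (1 - 1 / m) ≠ 0 := by positivity
    field_simp
  rw [← hlim]
  exact h.tendsto_primitive hm hℓ hcℓ
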